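/- All graphs are finite, simple and undirected. A path in a graph $G$ is a sequence $v_0v_1\dotsb v_l$ of distinct vertices in which consecutive vertices are adjacent; it contains the edges $v_{i-1}v_i$, $1\le i\le l$. A family $\mathcal{F}$ of paths in $G$ separates $E(G)$ if for every two different edges $e,f\in E(G)$ some path in $\mathcal{F}$ contains exactly one of $e$ and $f$, and it covers $E(G)$ if every edge of $G$ is contained in some path in $\mathcal{F}$. Let $\operatorname{sp}^{c}(G,E)$ be the minimum size of a family of paths in $G$ that both separates and covers $E(G)$. For a tree $T$, let $h_1(T)$ be the number of its leaves (vertices of degree $1$) and $h_2(T)$ the number of its vertices of degree $2$. Let $T^a$ be the binary tree of depth $2$, that is, the tree on the vertex set $\{1,2,3,4,5,6,7\}$ with edge set $\{12,13,24,25,36,37\}$. **Theorem.** We have $\operatorname{sp}^{c}(T^a,E)=4$, and for every tree $T$ whose number of vertices is not $2$ and which is not isomorphic to $T^a$, $$\operatorname{sp}^{c}(T,E)=\max\left\{\left\lceil\frac{2h_1(T)+h_2(T)}{3}\right\rceil,\left\lceil\frac{h_1(T)+h_2(T)}{2}\right\rceil\right\}.$$ -/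

import Mathlib

/-- A path of `G`, bundled with its two extremes: a sequence of distinct vertices in which
consecutive vertices are adjacent. -/
abbrev GraphPath {V : Type*} (G : SimpleGraph V) : Type _ :=
  Σ u v : V, G.Path u v

/-- The edge `e` is contained in the path `P`. -/
def GraphPath.HasEdge {V : Type*} {G : SimpleGraph V} (P : GraphPath G) (e : Sym2 V) : Prop :=
  e ∈ (P.2.2 : G.Walk P.1 P.2.1).edges

/-- `F` separates the edges of `G`: for every two different edges some path of `F` contains
exactly one of them. -/
def SeparatesEdges {V : Type*} (G : SimpleGraph V) (F : Finset (GraphPath G)) : Prop :=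
  ∀ e ∈ G.edgeSet, ∀ f ∈ G.edgeSet, e ≠ f →
    ∃ P ∈ F, (P.HasEdge e ∧ ¬ P.HasEdge f) ∨ (¬ P.HasEdge e ∧ P.HasEdge f)

/-- `F` covers the edges of `G`: every edge is contained in some path of `F`. -/
def CoversEdges {V : Type*} (G : SimpleGraph V) (F : Finset (GraphPath G)) : Prop :=
  ∀ e ∈ G.edgeSet, ∃ P ∈ F, P.HasEdge e

/-- The sizes of the edge-separating-covering path systems of `G`. -/
def sepCoverSizes {V : Type*} (G : SimpleGraph V) : Set ℕ :=
  {k | ∃ F : Finset (GraphPath G), SeparatesEdges G F ∧ CoversEdges G F ∧ F.card = k}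

/-- The minimum size of an edge-separating-covering path system of `G`. For a finite graph the
minimum is over a non-empty set, see `sepCoverSizes_nonempty`. -/
noncomputable def edgeSepCoverNumber {V : Type*} (G : SimpleGraph V) : ℕ :=
  sInf (sepCoverSizes G)

/-- In a finite graph the family of all paths separates and covers the edges, so that the
minimum in `edgeSepCoverNumber` is attained. -/
theorem sepCoverSizes_nonempty {V : Type*} [Finite V] (G : SimpleGraph V) :
    (sepCoverSizes G).Nonempty := by
  classical
  have := Fintype.ofFinite V
  have key : ∀ e ∈ G.edgeSet, ∃ P : GraphPath G, ∀ f, P.HasEdge f ↔ f = e := by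
    intro e
    induction e using Sym2.ind with
    | _ u v =>
      intro h
      have h' : G.Adj u v := h
      exact ⟨⟨u, v, SimpleGraph.Path.singleton h'⟩, fun f => by
        simp [GraphPath.HasEdge, SimpleGraph.Path.singleton]⟩
  refine ⟨_, Finset.univ, ?_, ?_, rfl⟩
  · intro e he f _ hef
    obtain ⟨P, hP⟩ := key e he
    exact ⟨P, Finset.mem_univ _, Or.inl ⟨(hP e).2 rfl, fun h => hef ((hP f).1 h).symm⟩⟩
  · intro e he
    obtain ⟨P, hP⟩ := key e he
    exact ⟨P, Finset.mem_univ _, (hP e).2 rfl⟩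

/-- The number of vertices of degree `d`; for `d = 1` this is the number of leaves. -/
def numDegree {V : Type*} [Fintype V] (G : SimpleGraph V) [DecidableRel G.Adj] (d : ℕ) : ℕ :=
  (Finset.univ.filter fun v => G.degree v = d).card

/-- The binary tree of depth `2`: the vertex `0` is the root, with children `1` and `2`, and the
leaves are `3`, `4` (below `1`) and `5`, `6` (below `2`). -/
def binaryTreeDepthTwo : SimpleGraph (Fin 7) :=
  SimpleGraph.fromEdgeSet {s(0, 1), s(0, 2), s(1, 3), s(1, 4), s(2, 5), s(2, 6)}

/-!
Call the vertices of degree `1` or `2` of a tree `T` its low vertices, and write `h₁`, `h₂` for the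
numbers of those of degree `1` and `2`.

**Lower bound.** Every low vertex is an end of some non-trivial path of a separating and covering
family `F`: a path through a leaf ends there, and a path containing exactly one of the two edges at
a vertex of degree `2` ends there. Hence `h₁ + h₂ ≤ 2|F|`. If only one path ends at each of two
leaves, these paths differ, since otherwise the two leaf edges lie on the same paths. So at most
`|F|` leaves are the end of only one path, and `2h₁ + h₂ ≤ 3|F|`.

**Upper bound.** A path of `T` is given by the pair of its ends, and it contains an edge `e` if and
only if its ends are on different sides of `e`. It thus contains exactly one of `e` and `f` if and
only if its ends are separated by the symmetric difference `X` of a side of `e` and a side of `f`,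
which is a set left by at most two edges. Such an `X` and its complement, if not empty, contain low
vertices, because the degrees in `X` add up to at most `2|X|` (`SimpleGraph.IsTree.sum_degree_le`).
It is therefore enough to find `k` pairs of vertices such that a set left by at most two edges and
crossed by no pair contains all low vertices or none (`Separable`,
`edgeSepCoverNumber_le_of_separable`). For instance, `n` vertices are separable by `n - 1` pairs,
and if two sets of vertices are separable by `k` and `j` pairs, then their union is separable by
`k + j` pairs, unless a cut by at most two edges splits one from the other (`Separable.union`).

Pairs with the required `k` are found by induction on the number of vertices
(`separable_lowVerts`). Suppressing low vertices of `T` gives a smaller tree, whose cuts are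
restrictions of cuts of `T` (`Reduction`), so that a solution for it is lifted to `T` by adding
pairs for the vertices suppressed. The set suppressed must not be cut off by two edges, and it has
the cost which the bound allows:
* two non-adjacent vertices of degree `2`, with one pair, if `h₂ ≥ h₁ + 2`;
* a single vertex of degree `2`, with one pair, if `h₂ = h₁ + 1`;
* a single leaf, with one pair, if `h₁` is `h₂ + 1` or `h₂ + 2`;
* a leaf and a vertex of degree `2`, with one pair, if `h₁ = h₂` or `h₁ ≥ h₂ + 3`, `h₂ ≥ 1`
  (`IsGoodPair`);
* three leaves, with two pairs, if `h₂ = 0` and `h₁ ≥ 6` (`exists_triple_no_cut`).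
When a leaf is suppressed, its neighbour must have degree at least `3`. A good pair is missing in
two cases only: if `h₁ = h₂` and each leaf is adjacent to its own vertex of degree `2`, where a
cyclic shift gives the pairs directly (`separable_of_subdivided_leaves`), and in the binary tree of
depth `2` (`exists_isGoodPair`). The induction must not run into the latter. It could do so only
from `h₁ = 5`, `h₂ = 2`, and there the good pair can be chosen such that a leaf becomes, or stays,
adjacent to a vertex of degree `2` (`exists_isGoodPair_of_five_leaves`).

For the binary tree of depth `2` the five low vertices are separable by four pairs, and all triples
of paths are checked.
-/

set_option linter.unusedSectionVars false

universe u

/-! ### Cuts of trees -/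

namespace SimpleGraph

section Cut

variable {V : Type*} [Fintype V] [DecidableEq V] (T : SimpleGraph V) [DecidableRel T.Adj]

/-- The number of edges of `T` with exactly one end in `X`. -/
def cutSize (X : Finset V) : ℕ := (T.interedges X Xᶜ).card

theorem cutSize_eq_sum (X : Finset V) :
    T.cutSize X = ∑ x ∈ X, (T.neighborFinset x \ X).card := by
  have h : T.interedges X Xᶜ =
      (X.sigma fun x => T.neighborFinset x \ X).map (Equiv.sigmaEquivProd V V).toEmbedding := by
    ext ⟨a, b⟩
    simp [mem_interedges_iff]
    tauto
  rw [cutSize, h, Finset.card_map, Finset.card_sigma]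

theorem cutSize_compl (X : Finset V) : T.cutSize Xᶜ = T.cutSize X := by
  unfold cutSize interedges
  rw [compl_compl]
  have : Std.Symm T.Adj := ⟨fun _ _ h => h.symm⟩
  exact Rel.card_interedges_comm _ _

/-- Moving `y` into `X` exchanges the edges from `y` to outside `X` and those from `y` to `X`. -/
theorem cutSize_add_card_inter {X : Finset V} {y : V} (hy : y ∉ X) :
    T.cutSize (insert y X) + (T.neighborFinset y ∩ X).card =
      T.cutSize X + (T.neighborFinset y \ X).card := by
  rw [cutSize_eq_sum, cutSize_eq_sum, Finset.sum_insert hy]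
  have h1 : T.neighborFinset y \ insert y X = T.neighborFinset y \ X := by
    ext z
    simp only [Finset.mem_sdiff, mem_neighborFinset, Finset.mem_insert, not_or]
    constructor
    · tauto
    · rintro ⟨h, h'⟩
      exact ⟨h, h.ne', h'⟩
  have h2 : ∀ x ∈ X, (T.neighborFinset x \ X).card =
      (T.neighborFinset x \ insert y X).card + if T.Adj y x then 1 else 0 := by
    intro x hx
    split_ifs with h
    · rw [Finset.sdiff_insert, Finset.card_erase_add_one]
      simp [hy, h.symm]
    · rw [Finset.sdiff_insert, Finset.erase_eq_of_notMem]
      · rfl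
      · simp [T.adj_comm, h]
  have h3 : (T.neighborFinset y ∩ X).card = ∑ x ∈ X, if T.Adj y x then 1 else 0 := by
    rw [← Finset.card_filter]
    congr 1
    ext z
    simp [and_comm]
  rw [Finset.sum_congr rfl h2, Finset.sum_add_distrib, h1, h3]
  omega

variable {T}

theorem Preconnected.exists_adj_of_mem_of_notMem (hT : T.Preconnected) {X : Finset V} {a b : V}
    (ha : a ∈ X) (hb : b ∉ X) : ∃ x ∈ X, ∃ y ∉ X, T.Adj x y := by
  obtain ⟨p⟩ := hT a b
  obtain ⟨d, -, h1, h2⟩ := p.exists_boundary_dart (X : Set V) (by simpa) (by simpa)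
  exact ⟨d.fst, by simpa using h1, d.snd, by simpa using h2, d.adj⟩

/-- A set of vertices of a connected graph that no edge leaves contains everything. -/
theorem Preconnected.mem_of_closed (hT : T.Preconnected) {X : Finset V}
    (hX : ∀ x ∈ X, ∀ y, T.Adj x y → y ∈ X) {a : V} (ha : a ∈ X) (b : V) : b ∈ X := by
  by_contra hb
  obtain ⟨x, hx, y, hy, h⟩ := hT.exists_adj_of_mem_of_notMem ha hb
  exact hy (hX x hx y h)

/-- In a connected graph at least `|Y|` edges meet a proper set `Y` of vertices. -/
theorem Preconnected.two_mul_card_le (hT : T.Preconnected) (n : ℕ) :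
    ∀ (Y : Finset V), Y.card = n → ∀ b ∉ Y, 2 * n ≤ ∑ y ∈ Y, T.degree y + T.cutSize Y := by
  induction n with
  | zero => simp
  | succ n ih =>
    intro Y hY b hb
    obtain ⟨a, ha⟩ : Y.Nonempty := Finset.card_pos.1 (by omega)
    obtain ⟨y, hy, z, hz, hyz⟩ := hT.exists_adj_of_mem_of_notMem ha hb
    have h1 := ih (Y.erase y) (by rw [Finset.card_erase_of_mem hy, hY]; rfl) b
      (fun h => hb (Finset.mem_of_mem_erase h))
    have h2 := T.cutSize_add_card_inter (Finset.notMem_erase y Y)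
    rw [Finset.insert_erase hy] at h2
    have h3 := Finset.sum_erase_add Y (fun y => T.degree y) hy
    have h4 : (T.neighborFinset y \ Y.erase y).card + (T.neighborFinset y ∩ Y.erase y).card =
        T.degree y := Finset.card_sdiff_add_card_inter _ _
    have h5 : 0 < (T.neighborFinset y \ Y.erase y).card :=
      Finset.card_pos.2 ⟨z, by simp [hyz, hz]⟩
    omega

theorem IsTree.sum_degree_add_two (hT : T.IsTree) :
    ∑ v, T.degree v + 2 = 2 * Fintype.card V := by
  have h := hT.card_edgeFinset
  have := T.sum_degrees_eq_twice_card_edges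
  omega

/-- A non-empty set `X` of vertices of a tree spans at most `|X| - 1` edges. -/
theorem IsTree.sum_degree_le (hT : T.IsTree) {X : Finset V} (hX : X.Nonempty) :
    ∑ x ∈ X, T.degree x + 2 ≤ 2 * X.card + T.cutSize X := by
  obtain ⟨b, hb⟩ := hX
  have h1 := hT.connected.preconnected.two_mul_card_le _ Xᶜ rfl b (by simpa)
  rw [cutSize_compl] at h1
  have h2 := hT.sum_degree_add_two
  have h3 := Finset.sum_add_sum_compl X (fun v => T.degree v)
  have h4 := Finset.card_add_card_compl X
  omega

theorem IsTree.degree_pos (hT : T.IsTree) (hV : 1 < Fintype.card V) (v : V) : 0 < T.degree v := by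
  have := Fintype.one_lt_card_iff_nontrivial.1 hV
  exact hT.connected.preconnected.degree_pos_of_nontrivial v

end Cut

end SimpleGraph

/-! ### Separable sets of vertices -/

open SimpleGraph

section System

variable {V : Type*} [Fintype V] [DecidableEq V] (T : SimpleGraph V) [DecidableRel T.Adj]

/-- There are `k` pairs of vertices such that a set `X` of vertices which none of these pairs
crosses and which at most two edges leave contains all of `S` or nothing of it. -/
def Separable (S : Finset V) (k : ℕ) : Prop :=
  ∃ D : List (V × V), D.length ≤ k ∧ ∀ X : Finset V, T.cutSize X ≤ 2 →
    (∀ p ∈ D, p.1 ∈ X ↔ p.2 ∈ X) → S ⊆ X ∨ Disjoint S X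

/-- The vertices of degree `1` or `2`. -/
def lowVerts : Finset V := Finset.univ.filter fun v => T.degree v = 1 ∨ T.degree v = 2

variable {T}

@[simp] theorem mem_lowVerts {v : V} : v ∈ lowVerts T ↔ T.degree v = 1 ∨ T.degree v = 2 := by
  simp [lowVerts]

theorem card_lowVerts : (lowVerts T).card = numDegree T 1 + numDegree T 2 := by
  rw [lowVerts, Finset.filter_or, Finset.card_union_of_disjoint]
  · rfl
  · rw [Finset.disjoint_filter]
    omega

theorem Separable.mono {S : Finset V} {k l : ℕ} (h : Separable T S k) (hkl : k ≤ l) :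
    Separable T S l := by
  obtain ⟨D, hD, h⟩ := h
  exact ⟨D, hD.trans hkl, h⟩

theorem separable_singleton (v : V) : Separable T {v} 0 := by
  refine ⟨[], le_rfl, fun X _ _ => ?_⟩
  by_cases h : v ∈ X
  · left; simpa
  · right; simpa

theorem Separable.insert {S : Finset V} {k : ℕ} (h : Separable T S k) (hS : S.Nonempty) (x : V) :
    Separable T (insert x S) (k + 1) := by
  obtain ⟨D, hD, h⟩ := h
  obtain ⟨s, hs⟩ := hS
  refine ⟨(x, s) :: D, by simpa, fun X hX hc => ?_⟩
  have h0 : x ∈ X ↔ s ∈ X := hc (x, s) (by simp)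
  rcases h X hX (fun p hp => hc p (by simp [hp])) with h1 | h1
  · left
    exact Finset.insert_subset (h0.2 (h1 hs)) h1
  · right
    rw [Finset.disjoint_insert_left]
    exact ⟨fun h => Finset.disjoint_left.1 h1 hs (h0.1 h), h1⟩

theorem separable_of_card_le {S : Finset V} {k : ℕ} (hS : S.Nonempty) (hk : S.card ≤ k + 1) :
    Separable T S k := by
  suffices Separable T S (S.card - 1) from this.mono (by omega)
  clear hk
  induction hS using Finset.Nonempty.cons_induction with
  | singleton a => exact separable_singleton a
  | cons a s ha hs ih =>
    rw [Finset.cons_eq_insert, Finset.card_insert_of_notMem ha]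
    have := hs.card_pos
    exact (ih.insert hs a).mono (by omega)

/-- Two separable sets can be combined, without a further pair, as soon as no cut by at most two
edges splits them from each other. -/
theorem Separable.union {S Q : Finset V} {k j : ℕ} (hS : Separable T S k) (hQ : Separable T Q j)
    (hSQ : ∀ X : Finset V, T.cutSize X ≤ 2 → Q ⊆ X → Disjoint S X → False) :
    Separable T (S ∪ Q) (k + j) := by
  obtain ⟨D, hD, h⟩ := hS
  obtain ⟨D', hD', h'⟩ := hQ
  refine ⟨D ++ D', by simp; omega, fun X hX hc => ?_⟩
  rcases h X hX (fun p hp => hc p (by simp [hp])) with h1 | h1 <;>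
    rcases h' X hX (fun p hp => hc p (by simp [hp])) with h2 | h2
  · exact Or.inl (Finset.union_subset h1 h2)
  · exact (hSQ Xᶜ (by rwa [cutSize_compl]) (Finset.subset_compl_iff_disjoint_right.2 h2)
      (by rwa [disjoint_compl_right_iff])).elim
  · exact (hSQ X hX h2 h1).elim
  · exact Or.inr (Finset.disjoint_union_left.2 ⟨h1, h2⟩)

end System

/-! ### Suppressing a vertex -/

namespace SimpleGraph

section Suppress

variable {V : Type*} [Fintype V] [DecidableEq V] (T : SimpleGraph V) [DecidableRel T.Adj]

/-- The graph obtained from `T` by deleting the vertex `x` and joining its neighbours to each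
other. In a tree this deletes a leaf together with its edge, and replaces a vertex of degree `2`
and its two edges by a single edge. -/
def suppress (x : V) : SimpleGraph {v // v ≠ x} where
  Adj a b := a ≠ b ∧ (T.Adj a b ∨ (T.Adj x a ∧ T.Adj x b))
  symm := ⟨fun _ _ h => ⟨h.1.symm, h.2.imp (fun h => h.symm) fun h => h.symm⟩⟩
  loopless := ⟨fun _ h => h.1 rfl⟩

instance (x : V) : DecidableRel (T.suppress x).Adj := fun a b =>
  inferInstanceAs (Decidable (a ≠ b ∧ (T.Adj a b ∨ (T.Adj x a ∧ T.Adj x b))))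

variable {T}

theorem suppress_adj {x : V} {a b : {v // v ≠ x}} :
    (T.suppress x).Adj a b ↔ a ≠ b ∧ (T.Adj a b ∨ (T.Adj x a ∧ T.Adj x b)) := Iff.rfl

theorem Adj.suppress {x : V} {a b : {v // v ≠ x}} (h : T.Adj a b) : (T.suppress x).Adj a b :=
  ⟨fun hab => h.ne (congrArg _ hab), Or.inl h⟩

/-- An edge leaving `X` that is new after suppressing `x` replaces an edge at `x` leaving `X`. -/
theorem cutSize_suppress_le {x : V} (hx : T.degree x ≤ 2) (X : Finset V) :
    (T.suppress x).cutSize (Finset.univ.filter fun a => (a : V) ∈ X) ≤ T.cutSize X := by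
  have huniq : ∀ a a' b : V, T.Adj x a → T.Adj x a' → T.Adj x b → a ≠ b → a' ≠ b → a = a' := by
    intro a a' b ha ha' hb hab hab'
    by_contra hne
    have : ({a, a', b} : Finset V) ⊆ T.neighborFinset x := by
      intro z; simp; rintro (rfl | rfl | rfl) <;> assumption
    have := Finset.card_le_card this
    rw [Finset.card_eq_three.2 ⟨a, a', b, hne, hab, hab', rfl⟩, card_neighborFinset_eq_degree]
      at this
    omega
  let g : {v // v ≠ x} × {v // v ≠ x} → V × V := fun p =>
    if T.Adj p.1 p.2 then (p.1, p.2) else if x ∈ X then (x, p.2) else (p.1, x)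
  refine Finset.card_le_card_of_injOn g ?_ ?_
  · rintro ⟨a, b⟩ h
    simp only [SetLike.mem_coe, mem_interedges_iff, Finset.mem_filter, Finset.mem_univ,
      Finset.mem_compl, true_and] at h
    obtain ⟨ha, hb, hab, h⟩ := h
    simp only [SetLike.mem_coe, mem_interedges_iff, g]
    split_ifs with h1 h2
    · exact ⟨ha, by simpa using hb, h1⟩
    · exact ⟨h2, by simpa using hb, (h.resolve_left h1).2⟩
    · exact ⟨ha, by simpa using h2, (h.resolve_left h1).1.symm⟩
  · rintro ⟨a, b⟩ h ⟨a', b'⟩ h' hg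
    simp only [SetLike.mem_coe, mem_interedges_iff, Finset.mem_filter, Finset.mem_univ,
      Finset.mem_compl, true_and] at h h'
    obtain ⟨ha, hb, hab, h⟩ := h
    obtain ⟨ha', hb', hab', h'⟩ := h'
    simp only [g] at hg
    have hx1 := a.2
    have hx2 := b.2
    have hx1' := a'.2
    have hx2' := b'.2
    rw [ne_eq, Subtype.ext_iff] at hab hab'
    simp only [Prod.mk.injEq, Subtype.ext_iff]
    split_ifs at hg with h1 h2 h3 h4 h5 h6 <;> simp only [Prod.mk.injEq] at hg
    · exact hg
    · exact (hx1 hg.1).elim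
    · exact (hx2 hg.2).elim
    · exact (hx1' hg.1.symm).elim
    · have e := h.resolve_left h1
      have e' := h'.resolve_left (by assumption)
      refine ⟨huniq a a' b e.1 e'.1 e.2 hab ?_, hg.2⟩
      rw [hg.2]; exact hab'
    · exact (hx2' hg.2.symm).elim
    · have e := h.resolve_left h1
      have e' := h'.resolve_left (by assumption)
      refine ⟨hg.1, huniq b b' a e.2 e'.2 e.1 (Ne.symm hab) ?_⟩
      rw [hg.1]; exact Ne.symm hab'

theorem Preconnected.suppress (hT : T.Preconnected) (x : V) : (T.suppress x).Preconnected := by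
  classical
  by_cases hd : ∃ y, T.Adj x y
  · obtain ⟨y, hy⟩ := hd
    let g : V → {v // v ≠ x} := fun v => if h : v = x then ⟨y, hy.ne'⟩ else ⟨v, h⟩
    have key : ∀ a b, T.Adj a b → (T.suppress x).Reachable (g a) (g b) := by
      intro a b hab
      by_cases he : g a = g b
      · rw [he]
      apply Adj.reachable
      refine ⟨he, ?_⟩
      by_cases ha : a = x
      · subst ha
        simp only [g, dif_pos, hab.ne', dif_neg, not_false_eq_true]
        exact Or.inr ⟨hy, hab⟩
      · by_cases hb : b = x
        · subst hb
          simp only [g, dif_pos, hab.ne, dif_neg, not_false_eq_true]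
          exact Or.inr ⟨hab.symm, hy⟩
        · simp only [g, ha, hb, dif_neg, not_false_eq_true]
          exact Or.inl hab
    have key2 : ∀ a b, T.Walk a b → (T.suppress x).Reachable (g a) (g b) := by
      intro a b p
      induction p with
      | nil => rfl
      | cons h _ ih => exact (key _ _ h).trans ih
    intro a b
    obtain ⟨p⟩ := hT a b
    have := key2 _ _ p
    simpa only [g, a.2, b.2, dif_neg, not_false_eq_true] using this
  · push Not at hd
    intro a
    obtain ⟨z, hz, y, -, hy⟩ := hT.exists_adj_of_mem_of_notMem (X := {x}) (b := a)
      (Finset.mem_singleton_self x) (by simpa using a.2)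
    rw [Finset.mem_singleton] at hz
    exact (hd y (hz ▸ hy)).elim

theorem IsTree.not_adj_of_common (hT : T.IsTree) {x a b : V} (ha : T.Adj x a) (hb : T.Adj x b) :
    ¬ T.Adj a b := fun hab =>
  hT.isAcyclic.cliqueFree le_rfl {x, a, b} (is3Clique_triple_iff.2 ⟨ha, hb, hab⟩)

theorem suppress_degree_of_not_adj {x : V} {a : {v // v ≠ x}} (h : ¬ T.Adj x a) :
    (T.suppress x).degree a = T.degree a := by
  rw [← card_neighborFinset_eq_degree, ← card_neighborFinset_eq_degree,
    ← Finset.card_map (Function.Embedding.subtype _)]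
  congr 1
  ext b
  simp only [Finset.mem_map, mem_neighborFinset, suppress_adj, Function.Embedding.coe_subtype]
  constructor
  · rintro ⟨c, ⟨-, h1 | h1⟩, rfl⟩
    · exact h1
    · exact (h h1.1).elim
  · intro hab
    have hbx : b ≠ x := by rintro rfl; exact h hab.symm
    exact ⟨⟨b, hbx⟩, Adj.suppress (x := x) (b := ⟨b, hbx⟩) hab, rfl⟩

theorem suppress_degree_of_adj (hT : T.IsTree) {x : V} {a : {v // v ≠ x}} (h : T.Adj x a) :
    (T.suppress x).degree a + 2 = T.degree a + T.degree x := by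
  have key : ((T.suppress x).neighborFinset a).map (Function.Embedding.subtype _) =
      (T.neighborFinset a).erase x ∪ (T.neighborFinset x).erase a := by
    ext b
    simp only [Finset.mem_map, mem_neighborFinset, suppress_adj, Function.Embedding.coe_subtype,
      Finset.mem_union, Finset.mem_erase]
    constructor
    · rintro ⟨c, ⟨h0, h1 | h1⟩, rfl⟩
      · exact Or.inl ⟨c.2, h1⟩
      · exact Or.inr ⟨fun h => h0 (Subtype.ext h.symm), h1.2⟩
    · rintro (⟨hb, hab⟩ | ⟨hb, hab⟩)
      · exact ⟨⟨b, hb⟩, Adj.suppress (x := x) (b := ⟨b, hb⟩) hab, rfl⟩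
      · exact ⟨⟨b, hab.ne'⟩, ⟨fun h => hb (congrArg Subtype.val h).symm, Or.inr ⟨h, hab⟩⟩, rfl⟩
  have hdisj : Disjoint ((T.neighborFinset a).erase x) ((T.neighborFinset x).erase a) := by
    rw [Finset.disjoint_left]
    intro b h1 h2
    simp only [Finset.mem_erase, mem_neighborFinset] at h1 h2
    exact hT.not_adj_of_common h h2.2 h1.2
  have := congrArg Finset.card key
  rw [Finset.card_map, Finset.card_union_of_disjoint hdisj, Finset.card_erase_of_mem (by simpa using h.symm),
    Finset.card_erase_of_mem (by simpa using h), card_neighborFinset_eq_degree, card_neighborFinset_eq_degree,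
    card_neighborFinset_eq_degree] at this
  have h1 : 0 < T.degree a := (T.degree_pos_iff_exists_adj _).2 ⟨x, h.symm⟩
  have h2 : 0 < T.degree x := (T.degree_pos_iff_exists_adj _).2 ⟨_, h⟩
  omega

theorem IsTree.suppress (hT : T.IsTree) {x : V} (hx : T.degree x = 1 ∨ T.degree x = 2) :
    (T.suppress x).IsTree := by
  obtain ⟨y, hy⟩ := (T.degree_pos_iff_exists_adj x).1 (by omega)
  have hne : Nonempty {v // v ≠ x} := ⟨⟨y, hy.ne'⟩⟩
  rw [isTree_iff_connected_and_card]
  refine ⟨⟨hT.connected.preconnected.suppress x⟩, ?_⟩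
  have h1 := (T.suppress x).sum_degrees_eq_twice_card_edges
  have h2 := hT.sum_degree_add_two
  have h3 : ∑ a : {v // v ≠ x}, T.degree a + T.degree x = ∑ v, T.degree v := by
    rw [← Finset.sum_erase_add _ _ (Finset.mem_univ x)]
    congr 1
    exact (Finset.sum_subtype (p := fun v => v ≠ x) (Finset.univ.erase x) (by simp)
      fun v => T.degree v).symm
  have h4 : ∑ a : {v // v ≠ x}, (T.suppress x).degree a + 2 * T.degree x =
      ∑ a : {v // v ≠ x}, T.degree a + T.degree x * T.degree x := by
    have e : ∀ a : {v // v ≠ x}, (T.suppress x).degree a + 2 * (if T.Adj x a then 1 else 0) =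
        T.degree a + T.degree x * (if T.Adj x a then 1 else 0) := by
      intro a
      split_ifs with h
      · simpa using suppress_degree_of_adj hT h
      · simpa using suppress_degree_of_not_adj h
    have e2 : ∑ a : {v // v ≠ x}, (if T.Adj x a then 1 else 0) = T.degree x := by
      rw [← card_neighborFinset_eq_degree, Finset.sum_boole, Nat.cast_id,
        ← Finset.card_map (Function.Embedding.subtype _)]
      congr 1
      ext b
      simp only [Finset.mem_map, Finset.mem_filter, Finset.mem_univ, true_and,
        Function.Embedding.coe_subtype, mem_neighborFinset]
      constructor
      · rintro ⟨c, h, rfl⟩; exact h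
      · intro h; exact ⟨⟨b, h.ne'⟩, h, rfl⟩
    have e3 := Finset.sum_congr (rfl : (Finset.univ : Finset {v // v ≠ x}) = _) fun a _ => e a
    rw [Finset.sum_add_distrib, Finset.sum_add_distrib, ← Finset.mul_sum, ← Finset.mul_sum,
      e2] at e3
    exact e3
  have h5 : Fintype.card {v // v ≠ x} + 1 = Fintype.card V := by
    rw [Fintype.card_of_subtype (Finset.univ.erase x) (by simp),
      Finset.card_erase_add_one (Finset.mem_univ x), Finset.card_univ]
  rw [Nat.card_eq_fintype_card, Nat.card_eq_fintype_card, ← edgeFinset_card]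
  rcases hx with hx | hx <;> rw [hx] at h3 h4 <;> omega

end Suppress

end SimpleGraph

/-! ### Reductions to smaller trees -/

/-- The tree `T'`, with vertices embedded by `f` into those of `T`, arises from `T` by
suppressing vertices: the vertices of degree `1` or `2` of `T'` are those of `T` outside `R`, with
the same degrees, and each cut of `T` restricts to a cut of `T'` by no more edges. -/
structure Reduction {V V' : Type*} [Fintype V] [DecidableEq V] [Fintype V'] [DecidableEq V']
    (T : SimpleGraph V) [DecidableRel T.Adj] (T' : SimpleGraph V') [DecidableRel T'.Adj]
    (f : V' ↪ V) (R : Finset V) : Prop where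
  isTree : T'.IsTree
  cutSize_le : ∀ X : Finset V,
    T'.cutSize (Finset.univ.filter fun a => f a ∈ X) ≤ T.cutSize X
  degree_eq_one : ∀ a, T'.degree a = 1 ↔ T.degree (f a) = 1
  degree_eq_two : ∀ a, T'.degree a = 2 ↔ T.degree (f a) = 2
  degree_le : ∀ a, T'.degree a ≤ T.degree (f a)
  notMem : ∀ a, f a ∉ R
  mem_range : ∀ x, T.degree x = 1 ∨ T.degree x = 2 → x ∉ R → x ∈ Set.range f
  adj : ∀ a b, T.Adj (f a) (f b) → T'.Adj a b

namespace Reduction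

variable {V V' V'' : Type*} [Fintype V] [DecidableEq V] [Fintype V'] [DecidableEq V']
  [Fintype V''] [DecidableEq V''] {T : SimpleGraph V} [DecidableRel T.Adj]
  {T' : SimpleGraph V'} [DecidableRel T'.Adj] {T'' : SimpleGraph V''} [DecidableRel T''.Adj]
  {f : V' ↪ V} {g : V'' ↪ V'} {R : Finset V} {R' : Finset V'}

theorem trans (h : Reduction T T' f R) (h' : Reduction T' T'' g R') :
    Reduction T T'' (g.trans f) (R ∪ R'.map f) where
  isTree := h'.isTree
  cutSize_le X := by
    have := h'.cutSize_le (Finset.univ.filter fun a => f a ∈ X)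
    simp only [Finset.mem_filter, Finset.mem_univ, true_and] at this
    exact this.trans (h.cutSize_le X)
  degree_eq_one a := (h'.degree_eq_one a).trans (h.degree_eq_one _)
  degree_eq_two a := (h'.degree_eq_two a).trans (h.degree_eq_two _)
  degree_le a := (h'.degree_le a).trans (h.degree_le _)
  notMem a := by
    have h1 := h.notMem (g a)
    have h2 := h'.notMem a
    simpa using ⟨h1, h2⟩
  mem_range x hx hxR := by
    simp only [Finset.mem_union, not_or] at hxR
    obtain ⟨y, rfl⟩ := h.mem_range x hx hxR.1
    rw [← h.degree_eq_one, ← h.degree_eq_two] at hx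
    obtain ⟨z, rfl⟩ := h'.mem_range y hx (by simpa using hxR.2)
    exact ⟨z, rfl⟩
  adj a b hab := h'.adj a b (h.adj _ _ hab)

theorem card_lt (h : Reduction T T' f R) (hR : R.Nonempty) :
    Fintype.card V' < Fintype.card V := by
  obtain ⟨r, hr⟩ := hR
  refine Fintype.card_lt_of_injective_of_notMem f f.injective (b := r) ?_
  rintro ⟨a, rfl⟩
  exact h.notMem a hr

theorem map_lowVerts (h : Reduction T T' f R) : (lowVerts T').map f = lowVerts T \ R := by
  ext x
  simp only [Finset.mem_map, mem_lowVerts, Finset.mem_sdiff]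
  constructor
  · rintro ⟨a, ha, rfl⟩
    rw [h.degree_eq_one, h.degree_eq_two] at ha
    exact ⟨ha, h.notMem a⟩
  · rintro ⟨hx, hxR⟩
    obtain ⟨a, rfl⟩ := h.mem_range x hx hxR
    rw [← h.degree_eq_one, ← h.degree_eq_two] at hx
    exact ⟨a, hx, rfl⟩

theorem numDegree_eq_add (h : Reduction T T' f R) {d : ℕ} (hd : d = 1 ∨ d = 2) :
    numDegree T d = numDegree T' d + (R.filter fun x => T.degree x = d).card := by
  have key : ∀ a, T'.degree a = d ↔ T.degree (f a) = d := by
    rcases hd with rfl | rfl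
    exacts [h.degree_eq_one, h.degree_eq_two]
  unfold numDegree
  rw [← Finset.card_map f, ← Finset.card_union_of_disjoint]
  · congr 1
    ext x
    simp only [Finset.mem_filter, Finset.mem_univ, true_and, Finset.mem_union, Finset.mem_map]
    constructor
    · intro hx
      by_cases hR : x ∈ R
      · exact Or.inr ⟨hR, hx⟩
      · obtain ⟨a, rfl⟩ := h.mem_range x (by rcases hd with rfl | rfl <;> simp [hx]) hR
        exact Or.inl ⟨a, (key a).2 hx, rfl⟩
    · rintro (⟨a, ha, rfl⟩ | hx)
      · exact (key a).1 ha
      · exact hx.2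
  · rw [Finset.disjoint_left]
    simp only [Finset.mem_map, Finset.mem_filter]
    rintro _ ⟨a, -, rfl⟩ h'
    exact h.notMem a h'.1

theorem separable (h : Reduction T T' f R) {k : ℕ} (hs : Separable T' (lowVerts T') k) :
    Separable T (lowVerts T \ R) k := by
  rw [← h.map_lowVerts]
  obtain ⟨D, hD, hs⟩ := hs
  refine ⟨D.map (Prod.map f f), by simpa, fun X hX hc => ?_⟩
  rcases hs _ ((h.cutSize_le X).trans hX) (fun p hp => by
    simpa using hc (Prod.map f f p) (List.mem_map_of_mem hp)) with h1 | h1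
  · left
    intro x hx
    obtain ⟨a, ha, rfl⟩ := Finset.mem_map.1 hx
    simpa using h1 ha
  · right
    rw [Finset.disjoint_left] at h1 ⊢
    intro x hx hX
    obtain ⟨a, ha, rfl⟩ := Finset.mem_map.1 hx
    exact h1 ha (by simpa using hX)

end Reduction

variable {V : Type u} [Fintype V] [DecidableEq V] {T : SimpleGraph V} [DecidableRel T.Adj]

theorem exists_reduction_of_degree_eq_two (hT : T.IsTree) {w : V} (hw : T.degree w = 2) :
    ∃ (V' : Type u) (_ : Fintype V') (_ : DecidableEq V') (T' : SimpleGraph V')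
      (_ : DecidableRel T'.Adj) (f : V' ↪ V), Reduction T T' f {w} ∧
      (∀ a b, a ≠ b → T.Adj w (f a) → T.Adj w (f b) → T'.Adj a b) := by
  have hdeg : ∀ a, (T.suppress w).degree a = T.degree a := by
    intro a
    by_cases h : T.Adj w a
    · have := suppress_degree_of_adj hT h
      omega
    · exact suppress_degree_of_not_adj h
  refine ⟨{v // v ≠ w}, inferInstance, inferInstance, T.suppress w, inferInstance,
    Function.Embedding.subtype _,
    ⟨hT.suppress (Or.inr hw), fun X => cutSize_suppress_le hw.le X,
      fun a => by rw [hdeg]; rfl, fun a => by rw [hdeg]; rfl, fun a => (hdeg a).le,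
      fun a => by simpa using a.2, fun x _ hx => ?_, fun a b h => h.suppress⟩,
    fun a b hab ha hb => ⟨hab, Or.inr ⟨ha, hb⟩⟩⟩
  exact ⟨⟨x, by simpa using hx⟩, rfl⟩

theorem SimpleGraph.eq_of_degree_eq_one {l v x : V} (hl : T.degree l = 1) (hv : T.Adj l v)
    (hx : T.Adj l x) : x = v := by
  obtain ⟨a, ha⟩ := Finset.card_eq_one.1 ((T.card_neighborFinset_eq_degree l).trans hl)
  rw [← mem_neighborFinset, ha, Finset.mem_singleton] at hv hx
  rw [hv, hx]

/-- A leaf whose neighbour `v` has degree at least `3` can be deleted; if this leaves `v` with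
degree `2`, then `v` is suppressed as well, which makes its remaining neighbours adjacent. -/
theorem exists_reduction_of_leaf (hT : T.IsTree) {l v : V} (hl : T.degree l = 1)
    (hlv : T.Adj l v) (hv : 3 ≤ T.degree v) :
    ∃ (V' : Type u) (_ : Fintype V') (_ : DecidableEq V') (T' : SimpleGraph V')
      (_ : DecidableRel T'.Adj) (f : V' ↪ V), Reduction T T' f {l} ∧
      (T.degree v = 3 → ∀ a b, a ≠ b → T.Adj v (f a) → T.Adj v (f b) → T'.Adj a b) := by
  have huniq : ∀ x, T.Adj l x → x = v := fun x hx => eq_of_degree_eq_one hl hlv hx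
  have hdv : (T.suppress l).degree ⟨v, hlv.ne'⟩ + 1 = T.degree v := by
    have := suppress_degree_of_adj hT (a := ⟨v, hlv.ne'⟩) hlv
    simp only at this
    omega
  have hdeg : ∀ a : {x // x ≠ l}, (a : V) ≠ v → (T.suppress l).degree a = T.degree a := fun a ha =>
    suppress_degree_of_not_adj fun h => ha (huniq _ h)
  have hT1 := hT.suppress (Or.inl hl)
  by_cases h3 : T.degree v = 3
  · have hd2 : (T.suppress l).degree ⟨v, hlv.ne'⟩ = 2 := by omega
    obtain ⟨V', i1, i2, T', i3, f, hf, hadj⟩ := exists_reduction_of_degree_eq_two hT1 hd2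
    have hne : ∀ a, ((f a : {x // x ≠ l}) : V) ≠ v := fun a h =>
      hf.notMem a (Finset.mem_singleton.2 (Subtype.ext h))
    refine ⟨V', i1, i2, T', i3, f.trans (Function.Embedding.subtype _),
      ⟨hf.isTree, fun X => ?_, fun a => ?_, fun a => ?_, fun a => ?_,
        fun a => by simpa using (f a).2, fun x hx hxl => ?_, fun a b h => hf.adj a b h.suppress⟩,
      fun _ a b hab ha hb => hadj a b hab (Adj.suppress ha) (Adj.suppress hb)⟩
    · have := hf.cutSize_le (Finset.univ.filter fun a => (a : V) ∈ X)
      simp only [Finset.mem_filter, Finset.mem_univ, true_and] at this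
      exact this.trans (cutSize_suppress_le (by omega) X)
    · rw [hf.degree_eq_one, hdeg _ (hne a)]; rfl
    · rw [hf.degree_eq_two, hdeg _ (hne a)]; rfl
    · exact (hf.degree_le a).trans (hdeg _ (hne a)).le
    · have hxv : x ≠ v := by rintro rfl; omega
      have hxl' : x ≠ l := by simpa using hxl
      obtain ⟨a, ha⟩ := hf.mem_range ⟨x, hxl'⟩ (by rw [hdeg _ hxv]; exact hx)
        (by simpa using hxv)
      exact ⟨a, by simp [ha]⟩
  · have hlow : ∀ a : {x // x ≠ l}, (T.suppress l).degree a = T.degree a ∨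
        3 ≤ (T.suppress l).degree a ∧ (T.suppress l).degree a < T.degree a := by
      intro a
      by_cases ha : (a : V) = v
      · right
        obtain rfl : a = ⟨v, hlv.ne'⟩ := Subtype.ext ha
        simp only
        omega
      · exact Or.inl (hdeg a ha)
    refine ⟨{x // x ≠ l}, inferInstance, inferInstance, T.suppress l, inferInstance,
      Function.Embedding.subtype _, ⟨hT1, fun X => cutSize_suppress_le (by omega) X,
      fun a => ?_, fun a => ?_, fun a => ?_, fun a => by simpa using a.2, fun x _ hx => ?_,
      fun a b h => h.suppress⟩, fun h => (h3 h).elim⟩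
    · have := hlow a
      change _ ↔ T.degree (a : V) = 1
      omega
    · have := hlow a
      change _ ↔ T.degree (a : V) = 2
      omega
    · have := hlow a
      change _ ≤ T.degree (a : V)
      omega
    · exact ⟨⟨x, by simpa using hx⟩, rfl⟩

/-! ### Pairs that no cut by two edges splits off -/

section NoCut

variable {V : Type*} [Fintype V] [DecidableEq V] {T : SimpleGraph V} [DecidableRel T.Adj]

theorem three_le_degree_of_disjoint (hT : T.IsTree) (hV : 1 < Fintype.card V) {Q X : Finset V}
    (hX : Disjoint (lowVerts T \ Q) X) {x : V} (hx : x ∈ X) (hxQ : x ∉ Q) : 3 ≤ T.degree x := by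
  have h1 := hT.degree_pos hV x
  have h2 : x ∉ lowVerts T := fun h =>
    Finset.disjoint_left.1 hX (Finset.mem_sdiff.2 ⟨h, hxQ⟩) hx
  rw [mem_lowVerts] at h2
  omega

theorem sum_degree_add_three_mul_le {Q X : Finset V} (hQ : Q ⊆ X)
    (hX : ∀ x ∈ X, x ∉ Q → 3 ≤ T.degree x) :
    ∑ x ∈ Q, T.degree x + 3 * X.card ≤ ∑ x ∈ X, T.degree x + 3 * Q.card := by
  have h1 := Finset.sum_sdiff (f := fun x => T.degree x) hQ
  have h2 := Finset.card_nsmul_le_sum (X \ Q) (fun x => T.degree x) 3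
    (fun x hx => hX x (Finset.mem_sdiff.1 hx).1 (Finset.mem_sdiff.1 hx).2)
  have h3 := Finset.card_sdiff_add_card_eq_card hQ
  simp only [smul_eq_mul] at h1 h2
  omega

theorem neighborFinset_sdiff_card_of_forall {X : Finset V} {x : V}
    (h : ∀ y ∈ X, ¬ T.Adj x y) : (T.neighborFinset x \ X).card = T.degree x := by
  rw [← card_neighborFinset_eq_degree, Finset.sdiff_eq_self_of_disjoint]
  rw [Finset.disjoint_left]
  intro y hy hyX
  exact h y hyX (by simpa using hy)

/-- The cut by a pair of non-adjacent vertices consists of all their edges. -/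
theorem cutSize_pair {a b : V} (hab : a ≠ b) (h : ¬ T.Adj a b) :
    T.cutSize {a, b} = T.degree a + T.degree b := by
  rw [cutSize_eq_sum, Finset.sum_pair hab, neighborFinset_sdiff_card_of_forall,
    neighborFinset_sdiff_card_of_forall]
  · simp [T.adj_comm, h]
  · simp [h]

theorem no_cut_of_degree_eq_two (hT : T.IsTree) (hV : 1 < Fintype.card V) {w w' : V}
    (hw : T.degree w = 2) (hw' : T.degree w' = 2) (hne : w ≠ w') (hadj : ¬ T.Adj w w')
    (X : Finset V) (hc : T.cutSize X ≤ 2) (hQ : {w, w'} ⊆ X)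
    (hX : Disjoint (lowVerts T \ {w, w'}) X) : False := by
  have h1 := hT.sum_degree_le (Finset.Nonempty.mono hQ ⟨w, by simp⟩)
  have h2 := sum_degree_add_three_mul_le (T := T) hQ
    fun x hx hxQ => three_le_degree_of_disjoint hT hV hX hx hxQ
  rw [Finset.sum_pair hne, Finset.card_pair hne] at h2
  obtain rfl := Finset.eq_of_subset_of_card_le hQ (by rw [Finset.card_pair hne]; omega)
  rw [cutSize_pair hne hadj] at hc
  omega

theorem no_cut_of_leaf_of_degree_eq_two (hT : T.IsTree) (hV : 1 < Fintype.card V) {l v w : V}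
    (hl : T.degree l = 1) (hlv : T.Adj l v) (hv : 3 ≤ T.degree v) (hw : T.degree w = 2)
    (hvw : T.degree v = 3 → ¬ T.Adj v w)
    (X : Finset V) (hc : T.cutSize X ≤ 2) (hQ : {l, w} ⊆ X)
    (hX : Disjoint (lowVerts T \ {l, w}) X) : False := by
  have hlX : l ∈ X := hQ (by simp)
  have hwX : w ∈ X := hQ (by simp)
  have hlw : l ≠ w := by rintro rfl; omega
  have hvw' : v ≠ w := by rintro rfl; omega
  have hwX' : w ∈ X.erase l := by simp [hlw.symm, hwX]
  have h1 := hT.sum_degree_le ⟨w, hwX'⟩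
  have h0 := T.cutSize_add_card_inter (Finset.notMem_erase l X)
  rw [Finset.insert_erase hlX] at h0
  have hN : T.neighborFinset l = {v} := by
    ext x
    simp only [mem_neighborFinset, Finset.mem_singleton]
    exact ⟨fun h => eq_of_degree_eq_one hl hlv h, fun h => h ▸ hlv⟩
  have hdeg : ∀ x ∈ X.erase l, x ≠ w → 3 ≤ T.degree x := fun x hx hxw =>
    three_le_degree_of_disjoint hT hV hX (Finset.mem_of_mem_erase hx)
      (by simpa [hxw] using Finset.ne_of_mem_erase hx)
  rw [hN] at h0
  by_cases hvX : v ∈ X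
  · have hvX' : v ∈ X.erase l := by simp [hlv.ne', hvX]
    have hsub : {v, w} ⊆ X.erase l := by
      simp [Finset.insert_subset_iff, hvX', hwX']
    have h2 := sum_degree_add_three_mul_le (T := T) hsub
      fun x hx hxQ => hdeg x hx (by rintro rfl; simp at hxQ)
    rw [Finset.sum_pair hvw', Finset.card_pair hvw'] at h2
    have h3 : ({v} ∩ X.erase l).card = 1 := by
      rw [Finset.singleton_inter_of_mem hvX']; rfl
    have h4 : ({v} \ X.erase l).card = 0 := by
      rw [Finset.card_eq_zero, Finset.sdiff_eq_empty_iff_subset]; simpa using hvX'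
    have hv2 := Finset.card_le_card hsub
    rw [Finset.card_pair hvw'] at hv2
    have hv3 : T.degree v = 3 := by omega
    have he := Finset.eq_of_subset_of_card_le hsub (by rw [Finset.card_pair hvw']; omega)
    rw [← he, cutSize_pair hvw' (hvw hv3), ] at h0
    rw [← he] at h3 h4
    omega
  · have h2 := sum_degree_add_three_mul_le (T := T) (Q := {w}) (by simpa using hwX')
      fun x hx hxQ => hdeg x hx (by simpa using hxQ)
    rw [Finset.sum_singleton, Finset.card_singleton] at h2
    have hvX' : v ∉ X.erase l := by simp [hvX]
    have h3 : ({v} ∩ X.erase l).card = 0 := by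
      rw [Finset.singleton_inter_of_notMem hvX']; rfl
    have h4 : ({v} \ X.erase l).card = 1 := by
      rw [Finset.sdiff_eq_self_of_disjoint (by simpa using fun _ => hvX)]; rfl
    omega

theorem exists_not_adj_of_degree_eq_two (hT : T.IsTree) (h : 3 ≤ numDegree T 2) :
    ∃ w w', T.degree w = 2 ∧ T.degree w' = 2 ∧ w ≠ w' ∧ ¬ T.Adj w w' := by
  obtain ⟨a, ha, b, hb, c, hc, hab, hac, hbc⟩ := Finset.two_lt_card.1 h
  simp only [Finset.mem_filter, Finset.mem_univ, true_and] at ha hb hc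
  by_cases h1 : T.Adj a b
  · by_cases h2 : T.Adj a c
    · exact ⟨b, c, hb, hc, hbc, hT.not_adj_of_common h1 h2⟩
    · exact ⟨a, c, ha, hc, hac, h2⟩
  · exact ⟨a, b, ha, hb, hab, h1⟩

/-- If at most two edges leave `X`, then these are any two different edges leaving `X`. -/
theorem eq_or_eq_of_cutSize_le_two {X : Finset V} (hX : T.cutSize X ≤ 2) {a b c d x y : V}
    (ha : a ∈ X) (hb : b ∉ X) (hab : T.Adj a b) (hc : c ∈ X) (hd : d ∉ X) (hcd : T.Adj c d)
    (hne : (a, b) ≠ (c, d)) (hx : x ∈ X) (hy : y ∉ X) (hxy : T.Adj x y) :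
    (x, y) = (a, b) ∨ (x, y) = (c, d) := by
  by_contra! h
  have : ({(a, b), (c, d), (x, y)} : Finset (V × V)) ⊆ T.interedges X Xᶜ := by
    intro p hp
    simp only [Finset.mem_insert, Finset.mem_singleton] at hp
    rcases hp with rfl | rfl | rfl <;> simp [mem_interedges_iff, *]
  have := Finset.card_le_card this
  rw [Finset.card_eq_three.2 ⟨_, _, _, hne, h.1.symm, h.2.symm, rfl⟩] at this
  exact absurd (this.trans hX) (by norm_num)

end NoCut

/-! ### Leaves and their neighbours -/

section Leaves

variable {V : Type*} [Fintype V] [DecidableEq V] {T : SimpleGraph V} [DecidableRel T.Adj]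

variable (T) in
/-- Some neighbour of `v`; for a leaf `v` this is its only neighbour. The value is `v` if `v` has
no neighbour. -/
noncomputable def someNeighbor (v : V) : V :=
  open Classical in if h : ∃ u, T.Adj v u then h.choose else v

theorem adj_someNeighbor {l : V} (hl : T.degree l = 1) : T.Adj l (someNeighbor T l) := by
  have h : ∃ u, T.Adj l u := (T.degree_pos_iff_exists_adj l).1 (by omega)
  rw [someNeighbor, dif_pos h]
  exact h.choose_spec

theorem eq_someNeighbor {l v : V} (hl : T.degree l = 1) (h : T.Adj l v) : v = someNeighbor T l :=
  eq_of_degree_eq_one hl (adj_someNeighbor hl) h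

theorem card_eq_of_closed (hT : T.IsTree) {X : Finset V} (hne : X.Nonempty)
    (h : ∀ x ∈ X, ∀ y, T.Adj x y → y ∈ X) : Fintype.card V = X.card := by
  obtain ⟨a, ha⟩ := hne
  rw [← Finset.card_univ, (Finset.eq_univ_iff_forall.2
    fun b => hT.connected.preconnected.mem_of_closed h ha b : X = Finset.univ)]

theorem two_le_degree_of_adj_leaf (hT : T.IsTree) (hV : 3 ≤ Fintype.card V) {l v : V}
    (hl : T.degree l = 1) (h : T.Adj l v) : 2 ≤ T.degree v := by
  have hp := hT.degree_pos (by omega) v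
  by_contra hv
  have hv1 : T.degree v = 1 := by omega
  have := card_eq_of_closed hT (X := {l, v}) ⟨l, by simp⟩ (by
    intro x hx y hxy
    simp only [Finset.mem_insert, Finset.mem_singleton] at hx ⊢
    rcases hx with rfl | rfl
    · exact Or.inr (eq_of_degree_eq_one hl h hxy)
    · exact Or.inl (eq_of_degree_eq_one hv1 h.symm hxy))
  rw [Finset.card_pair h.ne] at this
  omega

theorem leaf_unique_of_degree_eq_two (hT : T.IsTree) (hV : 4 ≤ Fintype.card V) {l l' w : V}
    (hl : T.degree l = 1) (hl' : T.degree l' = 1) (hw : T.degree w = 2) (h : T.Adj l w)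
    (h' : T.Adj l' w) : l = l' := by
  by_contra hne
  have hN : T.neighborFinset w = {l, l'} := by
    symm
    apply Finset.eq_of_subset_of_card_le
    · simp [Finset.insert_subset_iff, h.symm, h'.symm]
    · rw [card_neighborFinset_eq_degree, hw, Finset.card_pair hne]
  have := card_eq_of_closed hT (X := {w, l, l'}) ⟨w, by simp⟩ (by
    intro x hx y hxy
    simp only [Finset.mem_insert, Finset.mem_singleton] at hx
    rcases hx with rfl | rfl | rfl
    · rw [← mem_neighborFinset, hN] at hxy
      exact Finset.mem_insert_of_mem hxy
    · simp [eq_of_degree_eq_one hl h hxy]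
    · simp [eq_of_degree_eq_one hl' h' hxy])
  have h3 := Finset.card_le_three (a := w) (b := l) (c := l')
  omega

/-- Each vertex of degree `2` is adjacent to at most one leaf. -/
theorem card_leaves_adj_degree_two_le (hT : T.IsTree) (hV : 4 ≤ Fintype.card V) (A : Finset V)
    (hA : ∀ l w, T.degree l = 1 → T.degree w = 2 → T.Adj l w → w ∈ A) :
    (Finset.univ.filter fun l =>
      T.degree l = 1 ∧ T.degree (someNeighbor T l) = 2).card ≤ A.card := by
  refine Finset.card_le_card_of_injOn (someNeighbor T) ?_ ?_
  · intro l hl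
    simp only [Finset.coe_filter, Finset.mem_univ, true_and, Set.mem_ofPred_eq] at hl
    exact hA l _ hl.1 hl.2 (adj_someNeighbor hl.1)
  · intro l hl l' hl' he
    simp only [Finset.coe_filter, Finset.mem_univ, true_and, Set.mem_ofPred_eq] at hl hl'
    exact leaf_unique_of_degree_eq_two hT hV hl.1 hl'.1 hl.2 (adj_someNeighbor hl.1)
      (he ▸ adj_someNeighbor hl'.1)

theorem card_free_leaves_add (hT : T.IsTree) (hV : 3 ≤ Fintype.card V) :
    (Finset.univ.filter fun l =>
      T.degree l = 1 ∧ T.degree (someNeighbor T l) = 2).card +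
    (Finset.univ.filter fun l =>
      T.degree l = 1 ∧ 3 ≤ T.degree (someNeighbor T l)).card = numDegree T 1 := by
  rw [numDegree, ← Finset.card_union_of_disjoint]
  · congr 1
    ext l
    simp only [Finset.mem_union, Finset.mem_filter, Finset.mem_univ, true_and]
    constructor
    · tauto
    · intro hl
      have := two_le_degree_of_adj_leaf hT hV hl (adj_someNeighbor hl)
      have : T.degree (someNeighbor T l) = 2 ∨ 3 ≤ T.degree (someNeighbor T l) := by omega
      tauto
  · rw [Finset.disjoint_filter]
    omega

/-- A tree all of whose leaves are adjacent to vertices of degree `2`, with as many leaves as such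
vertices: join each leaf to the neighbour of the next leaf in a cyclic order. -/
theorem separable_of_subdivided_leaves (hT : T.IsTree) (hV : 4 ≤ Fintype.card V)
    (h12 : numDegree T 1 = numDegree T 2) (h1 : 0 < numDegree T 1)
    (hL : ∀ l, T.degree l = 1 → T.degree (someNeighbor T l) = 2) :
    Separable T (lowVerts T) (numDegree T 1) := by
  have hn : NeZero (numDegree T 1) := ⟨h1.ne'⟩
  let e : Fin (numDegree T 1) ≃ {l // l ∈ Finset.univ.filter fun v => T.degree v = 1} :=
    (Finset.equivFin _).symm
  have he : ∀ i, T.degree (e i : V) = 1 := fun i =>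
    (Finset.mem_filter.1 (e i).2).2
  have hsurj : ∀ l, T.degree l = 1 → ∃ i, (e i : V) = l := fun l hl =>
    ⟨e.symm ⟨l, by simpa using hl⟩, by simp⟩
  have hsurj2 : ∀ w, T.degree w = 2 → ∃ i, someNeighbor T (e i) = w := by
    have hinj : Set.InjOn (someNeighbor T)
        (Finset.univ.filter fun v => T.degree v = 1 : Finset V) := by
      intro l hl l' hl' h
      simp only [Finset.coe_filter, Finset.mem_univ, true_and, Set.mem_ofPred_eq] at hl hl'
      exact leaf_unique_of_degree_eq_two hT hV hl hl' (hL l hl) (adj_someNeighbor hl)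
        (h ▸ adj_someNeighbor hl')
    have himg : (Finset.univ.filter fun v => T.degree v = 1).image (someNeighbor T) =
        Finset.univ.filter fun v => T.degree v = 2 := by
      apply Finset.eq_of_subset_of_card_le
      · intro w hw
        simp only [Finset.mem_image, Finset.mem_filter, Finset.mem_univ, true_and] at hw ⊢
        obtain ⟨l, hl, rfl⟩ := hw
        exact hL l hl
      · rw [Finset.card_image_of_injOn hinj]
        exact h12.ge
    intro w hw
    have : w ∈ (Finset.univ.filter fun v => T.degree v = 1).image (someNeighbor T) := by
      rw [himg]; simpa using hw
    simp only [Finset.mem_image, Finset.mem_filter, Finset.mem_univ, true_and] at this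
    obtain ⟨l, hl, rfl⟩ := this
    obtain ⟨i, rfl⟩ := hsurj l hl
    exact ⟨i, rfl⟩
  refine ⟨List.ofFn fun i => ((e i : V), someNeighbor T (e (i + 1))), by simp, fun X hX hc => ?_⟩
  have hc' : ∀ i, (e i : V) ∈ X ↔ someNeighbor T (e (i + 1)) ∈ X := fun i =>
    hc _ (List.mem_ofFn.2 ⟨i, rfl⟩)
  have hpred : ∀ i, ∃ j : Fin (numDegree T 1), j + 1 = i := fun i => ⟨i - 1, by simp⟩
  have hcyc : ∀ P : Fin (numDegree T 1) → Prop, (∀ i, P i → P (i + 1)) →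
      ∀ a b, P a → P b := by
    intro P hP a b ha
    have : ∀ k : ℕ, P (a + (Fin.ofNat _ k)) := by
      intro k
      induction k with
      | zero => simpa using ha
      | succ k ih =>
        have := hP _ ih
        have h : a + Fin.ofNat (numDegree T 1) (k + 1) =
            a + Fin.ofNat (numDegree T 1) k + 1 := by
          rw [add_assoc]
          congr 1
          simp [Fin.ext_iff, Fin.val_add]
        rwa [h]
    have h := this (b - a).val
    simpa using h
  by_cases hup : ∃ i, (e i : V) ∈ X ∧ (e (i + 1) : V) ∉ X
  swap
  · push Not at hup
    have hconst := hcyc (fun i => (e i : V) ∈ X) hup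
    by_cases h0 : (e 0 : V) ∈ X
    · left
      intro x hx
      rcases mem_lowVerts.1 hx with hx | hx
      · obtain ⟨i, rfl⟩ := hsurj x hx
        exact hconst _ _ h0
      · obtain ⟨i, rfl⟩ := hsurj2 x hx
        obtain ⟨j, rfl⟩ := hpred i
        exact (hc' j).1 (hconst _ _ h0)
    · right
      rw [Finset.disjoint_left]
      intro x hx hxX
      rcases mem_lowVerts.1 hx with hx | hx
      · obtain ⟨i, rfl⟩ := hsurj x hx
        exact h0 (hconst _ _ hxX)
      · obtain ⟨i, rfl⟩ := hsurj2 x hx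
        obtain ⟨j, rfl⟩ := hpred i
        exact h0 (hconst _ _ ((hc' j).2 hxX))
  obtain ⟨i, hi, hi'⟩ := hup
  obtain ⟨j, hj, hj'⟩ : ∃ j, (e j : V) ∉ X ∧ (e (j + 1) : V) ∈ X := by
    by_contra! h
    exact hcyc (fun i => (e i : V) ∉ X) h _ _ hi' hi
  -- The edges at the leaves `l` and `m` leave `X`, in opposite directions, and no others do.
  obtain ⟨l, hl, hlX, hlX'⟩ : ∃ l, T.degree l = 1 ∧ l ∈ X ∧ someNeighbor T l ∉ X :=
    ⟨_, he (j + 1), hj', fun h => hj ((hc' j).2 h)⟩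
  obtain ⟨m, hm, hmX, hmX'⟩ : ∃ m, T.degree m = 1 ∧ m ∉ X ∧ someNeighbor T m ∈ X :=
    ⟨_, he (i + 1), hi', (hc' i).1 hi⟩
  have hl2 := hL l hl
  have hm2 := hL m hm
  have hlm : l ≠ m := fun h => hmX (h ▸ hlX)
  have hclosed : ∀ x ∈ insert m (X.erase l), ∀ y, T.Adj x y → y ∈ insert m (X.erase l) := by
    intro x hx y hxy
    by_contra hy
    simp only [Finset.mem_insert, Finset.mem_erase, not_or, not_and] at hx hy
    rcases eq_or_ne x m with rfl | hxm
    · have := eq_someNeighbor hm hxy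
      subst this
      exact hy.2 (fun h => by rw [h] at hm2; omega) hmX'
    · obtain ⟨hxl, hxX⟩ := hx.resolve_left hxm
      rcases eq_or_ne y l with rfl | hyl
      · exact hlX' (eq_someNeighbor hl hxy.symm ▸ hxX)
      · rcases eq_or_eq_of_cutSize_le_two hX hlX hlX' (adj_someNeighbor hl) hmX' hmX
          (adj_someNeighbor hm).symm (fun h => by
            have h' : l = someNeighbor T m := (Prod.ext_iff.1 h).1
            rw [h'] at hl
            omega) hxX (hy.2 hyl) hxy with h | h
        · exact hxl (Prod.ext_iff.1 h).1
        · exact hy.1 (Prod.ext_iff.1 h).2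
  have := hT.connected.preconnected.mem_of_closed hclosed (Finset.mem_insert_self _ _)
    (someNeighbor T l)
  simp only [Finset.mem_insert, Finset.mem_erase] at this
  rcases this with h | h
  · rw [h] at hl2; omega
  · exact absurd h.2 hlX'

end Leaves

/-! ### Triples of leaves in trees without vertices of degree two -/

section Triple

variable {V : Type*} [Fintype V] [DecidableEq V] {T : SimpleGraph V} [DecidableRel T.Adj]

/-- If only leaf edges leave `X`, then all vertices that are not leaves lie on the same side, so
that one edge leaves `X` for each leaf on the other side. -/
theorem exists_adj_of_triple (hT : T.IsTree) (hV : 3 ≤ Fintype.card V) (h1 : 6 ≤ numDegree T 1)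
    {a b d : V} (hab : a ≠ b) (had : a ≠ d) (hbd : b ≠ d) (ha : T.degree a = 1)
    (hb : T.degree b = 1) (hd : T.degree d = 1) {X : Finset V} (hX : T.cutSize X ≤ 2)
    (haX : a ∈ X) (hbX : b ∈ X) (hdX : d ∈ X)
    (hX' : ∀ l, T.degree l = 1 → l ≠ a → l ≠ b → l ≠ d → l ∉ X) :
    ∃ x y, x ∈ X ∧ y ∉ X ∧ T.Adj x y ∧ T.degree x ≠ 1 ∧ T.degree y ≠ 1 := by
  by_contra! hno
  have hnb : ∀ l, T.degree l = 1 → T.degree (someNeighbor T l) ≠ 1 := fun l hl => by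
    have := two_le_degree_of_adj_leaf hT hV hl (adj_someNeighbor hl)
    omega
  let g : V → V := fun v => if T.degree v = 1 then someNeighbor T v else v
  have hg : ∀ x y, T.Adj x y → g x ∈ X → g y ∈ X := by
    intro x y hxy hx
    by_cases h1 : T.degree x = 1
    · rw [eq_someNeighbor h1 hxy]
      simpa [g, h1, hnb x h1] using hx
    · by_cases h2 : T.degree y = 1
      · rw [eq_someNeighbor h2 hxy.symm] at hx
        simpa [g, h2, hnb y h2] using hx
      · simp only [g, h1, h2, if_false] at hx ⊢
        by_contra hy
        exact h2 (hno x y hx hy hxy h1)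
  have hside : ∀ x y, g x ∈ X → g y ∈ X := fun x y hx => by
    have := hT.connected.preconnected.mem_of_closed
      (X := Finset.univ.filter fun v => g v ∈ X) (by simpa using fun x hx y hxy => hg x y hxy hx)
      (by simpa using hx) y
    simpa using this
  by_cases h0 : g a ∈ X
  · have hin : ∀ l, T.degree l = 1 → someNeighbor T l ∈ X := fun l hl => by
      simpa [g, hl] using hside a l h0
    have hcard : 3 ≤ ((Finset.univ.filter fun v => T.degree v = 1) \ {a, b, d}).card := by
      have := Finset.le_card_sdiff {a, b, d} (Finset.univ.filter fun v => T.degree v = 1)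
      have h3 := Finset.card_le_three (a := a) (b := b) (c := d)
      unfold numDegree at h1
      omega
    obtain ⟨p, hp, q, hq, r, hr, hpq, hpr, hqr⟩ := Finset.two_lt_card.1 hcard
    simp only [Finset.mem_sdiff, Finset.mem_filter, Finset.mem_univ, true_and, Finset.mem_insert,
      Finset.mem_singleton, not_or] at hp hq hr
    rcases eq_or_eq_of_cutSize_le_two hX
      (hin p hp.1) (hX' p hp.1 hp.2.1 hp.2.2.1 hp.2.2.2) (adj_someNeighbor hp.1).symm
      (hin q hq.1) (hX' q hq.1 hq.2.1 hq.2.2.1 hq.2.2.2) (adj_someNeighbor hq.1).symm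
      (fun h => hpq (Prod.ext_iff.1 h).2)
      (hin r hr.1) (hX' r hr.1 hr.2.1 hr.2.2.1 hr.2.2.2) (adj_someNeighbor hr.1).symm with h | h
    · exact hpr (Prod.ext_iff.1 h).2.symm
    · exact hqr (Prod.ext_iff.1 h).2.symm
  · have hout : ∀ l, T.degree l = 1 → someNeighbor T l ∉ X := fun l hl h =>
      h0 (hside l a (by simpa [g, hl] using h))
    rcases eq_or_eq_of_cutSize_le_two hX
      haX (hout a ha) (adj_someNeighbor ha) hbX (hout b hb) (adj_someNeighbor hb)
      (fun h => hab (Prod.ext_iff.1 h).1) hdX (hout d hd) (adj_someNeighbor hd) with h | h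
    · exact had (Prod.ext_iff.1 h).1.symm
    · exact hbd (Prod.ext_iff.1 h).1.symm

variable (T) in
/-- The leaves adjacent to `c`. -/
def leavesAt (c : V) : Finset V := Finset.univ.filter fun l => T.degree l = 1 ∧ T.Adj c l

theorem mem_leavesAt {c l : V} : l ∈ leavesAt T c ↔ T.degree l = 1 ∧ T.Adj c l := by
  simp [leavesAt]

/-- Without vertices of degree `2`, either the tree is a star or two of its vertices are adjacent
to two leaves each. This is a count of the leaves against the degrees of the other vertices. -/
theorem exists_two_le_card_leavesAt (hT : T.IsTree) (hV : 3 ≤ Fintype.card V)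
    (h2 : numDegree T 2 = 0) :
    (∃ c, ∀ x, T.Adj c x → T.degree x = 1) ∨
      ∃ c c', c ≠ c' ∧ 2 ≤ (leavesAt T c).card ∧ 2 ≤ (leavesAt T c').card := by
  by_contra! h
  obtain ⟨hstar, hend⟩ := h
  have h2' : ∀ v, T.degree v ≠ 2 := fun v hv => by
    have : v ∈ Finset.univ.filter fun v => T.degree v = 2 := by simpa using hv
    rw [Finset.card_eq_zero.1 h2] at this
    simp at this
  set B := Finset.univ.filter fun v => T.degree v ≠ 1
  have hB : ∀ c ∈ B, 3 ≤ T.degree c := fun c hc => by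
    have h := (Finset.mem_filter.1 hc).2
    have := h2' c
    have := hT.degree_pos (by omega) c
    omega
  have hsum : numDegree T 1 = ∑ c ∈ B, (leavesAt T c).card := by
    rw [numDegree, Finset.card_eq_sum_card_fiberwise (f := someNeighbor T) (t := B)]
    · refine Finset.sum_congr rfl fun c _ => ?_
      congr 1
      ext l
      simp only [Finset.mem_filter, Finset.mem_univ, true_and, mem_leavesAt]
      refine and_congr_right fun hl => ⟨?_, fun h => (eq_someNeighbor hl h.symm).symm⟩
      rintro rfl
      exact (adj_someNeighbor hl).symm
    · intro l hl
      simp only [Finset.coe_filter, Finset.mem_univ, true_and, Set.mem_ofPred_eq] at hl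
      have := two_le_degree_of_adj_leaf hT hV hl (adj_someNeighbor hl)
      simp [B]
      omega
  have hdeg : ∑ c ∈ B, T.degree c + 2 = numDegree T 1 + 2 * B.card := by
    have e1 := hT.sum_degree_add_two
    have e2 := Finset.sum_filter_add_sum_filter_not Finset.univ (fun v => T.degree v = 1)
      (fun v => T.degree v)
    have e3 : ∑ v with T.degree v = 1, T.degree v = numDegree T 1 := by
      rw [Finset.sum_congr rfl (g := fun _ => 1) (fun v hv => (Finset.mem_filter.1 hv).2)]
      simp [numDegree]
    have e4 := Finset.card_filter_add_card_filter_not (s := (Finset.univ : Finset V))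
      (fun v => T.degree v = 1)
    rw [Finset.card_univ] at e4
    change numDegree T 1 + B.card = _ at e4
    change _ + ∑ v ∈ B, T.degree v = _ at e2
    omega
  have hle : ∑ c ∈ B, ((leavesAt T c).card + 2) ≤
      ∑ c ∈ B, (T.degree c + if 2 ≤ (leavesAt T c).card then 1 else 0) := by
    refine Finset.sum_le_sum fun c hc => ?_
    have h3 := hB c hc
    obtain ⟨x, hx, hx'⟩ := hstar c
    have hlt : (leavesAt T c).card < T.degree c := by
      rw [← card_neighborFinset_eq_degree]
      refine Finset.card_lt_card ⟨fun l hl => ?_, fun h => hx' ?_⟩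
      · simpa using (mem_leavesAt.1 hl).2
      · exact (mem_leavesAt.1 (h (by simpa using hx))).1
    split_ifs <;> omega
  have hone : ∑ c ∈ B, (if 2 ≤ (leavesAt T c).card then 1 else 0) ≤ 1 := by
    rw [← Finset.card_filter, Finset.card_le_one]
    intro c hc c' hc'
    by_contra hne
    have := hend c c' hne (Finset.mem_filter.1 hc).2
    have := (Finset.mem_filter.1 hc').2
    omega
  rw [Finset.sum_add_distrib, Finset.sum_add_distrib, Finset.sum_const, smul_eq_mul, ← hsum] at hle
  omega

/-- Without vertices of degree `2` some three of at least six leaves are not cut off from all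
others by two edges: take leaves at two different ends of the tree, both ends keeping another. -/
theorem exists_triple_no_cut (hT : T.IsTree) (hV : 3 ≤ Fintype.card V)
    (h1 : 6 ≤ numDegree T 1) (h2 : numDegree T 2 = 0) :
    ∃ a b d, a ≠ b ∧ a ≠ d ∧ b ≠ d ∧ T.degree a = 1 ∧ T.degree b = 1 ∧ T.degree d = 1 ∧
      ∀ X : Finset V, T.cutSize X ≤ 2 → {a, b, d} ⊆ X →
        Disjoint (lowVerts T \ {a, b, d}) X → False := by
  have hred : ∀ {a b d : V} {X : Finset V}, Disjoint (lowVerts T \ {a, b, d}) X →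
      ∀ l, T.degree l = 1 → l ≠ a → l ≠ b → l ≠ d → l ∉ X := by
    intro a b d X hX l hl ha hb hd
    exact Finset.disjoint_left.1 hX (by simp [hl, ha, hb, hd])
  rcases exists_two_le_card_leavesAt hT hV h2 with ⟨c, hc⟩ | ⟨c, c', hcc, hc, hc'⟩
  · obtain ⟨a, ha, b, hb, d, hd, hab, had, hbd⟩ :=
      Finset.two_lt_card.1 (show 2 < numDegree T 1 by omega)
    simp only [Finset.mem_filter, Finset.mem_univ, true_and] at ha hb hd
    refine ⟨a, b, d, hab, had, hbd, ha, hb, hd, fun X hX hQ hdis => ?_⟩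
    simp only [Finset.insert_subset_iff, Finset.singleton_subset_iff] at hQ
    obtain ⟨x, y, -, -, hxy, hx, hy⟩ := exists_adj_of_triple hT hV h1 hab had hbd ha hb hd hX
      hQ.1 hQ.2.1 hQ.2.2 (hred hdis)
    have hall : ∀ z, z = c ∨ T.Adj c z := by
      intro z
      have := hT.connected.preconnected.mem_of_closed (X := insert c (T.neighborFinset c)) (by
        intro u hu v huv
        simp only [Finset.mem_insert, mem_neighborFinset] at hu ⊢
        rcases hu with rfl | hu
        · exact Or.inr huv
        · exact Or.inl (eq_of_degree_eq_one (hc u hu) hu.symm huv)) (Finset.mem_insert_self _ _) z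
      simpa using this
    have hx' := (hall x).resolve_right fun h => hx (hc x h)
    have hy' := (hall y).resolve_right fun h => hy (hc y h)
    exact hxy.ne (hx'.trans hy'.symm)
  · obtain ⟨a, ha, a', ha', haa⟩ := Finset.one_lt_card.1 hc
    obtain ⟨b, hb, b', hb', hbb⟩ := Finset.one_lt_card.1 hc'
    rw [mem_leavesAt] at ha ha' hb hb'
    have hdisj : ∀ {p q}, T.degree p = 1 → T.Adj c p → T.Adj c' q → p ≠ q := by
      rintro p q hp h h' rfl
      exact hcc (eq_of_degree_eq_one hp h'.symm h.symm)
    have hab : a ≠ b := hdisj ha.1 ha.2 hb.2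
    have hab' : a ≠ b' := hdisj ha.1 ha.2 hb'.2
    have ha'b : a' ≠ b := hdisj ha'.1 ha'.2 hb.2
    have ha'b' : a' ≠ b' := hdisj ha'.1 ha'.2 hb'.2
    obtain ⟨d, hd⟩ : ((Finset.univ.filter fun v => T.degree v = 1) \ {a, b, a', b'}).Nonempty := by
      rw [← Finset.card_pos]
      have := Finset.le_card_sdiff {a, b, a', b'} (Finset.univ.filter fun v => T.degree v = 1)
      have h3 := Finset.card_le_four (a := a) (b := b) (c := a') (d := b')
      unfold numDegree at h1
      omega
    simp only [Finset.mem_sdiff, Finset.mem_filter, Finset.mem_univ, true_and, Finset.mem_insert,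
      Finset.mem_singleton, not_or] at hd
    obtain ⟨hd, hda, hdb, hda', hdb'⟩ := hd
    refine ⟨a, b, d, hab, Ne.symm hda, Ne.symm hdb, ha.1, hb.1, hd, fun X hX hQ hdis => ?_⟩
    simp only [Finset.insert_subset_iff, Finset.singleton_subset_iff] at hQ
    obtain ⟨x, y, hxX, hyX, hxy, hx, hy⟩ := exists_adj_of_triple hT hV h1 hab (Ne.symm hda)
      (Ne.symm hdb) ha.1 hb.1 hd hX hQ.1 hQ.2.1 hQ.2.2 (hred hdis)
    -- One edge at `c` and one edge at `c'` lead to a leaf on the other side of `X`.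
    have hcross : ∀ {c p p' : V}, T.degree p = 1 → T.degree p' = 1 → T.Adj c p → T.Adj c p' →
        p ∈ X → p' ∉ X → ∃ u v, u ∈ X ∧ v ∉ X ∧ T.Adj u v ∧
          (u = p ∧ v = c ∨ u = c ∧ v = p') := by
      intro c p p' _ _ h h' hp hp'
      by_cases hcX : c ∈ X
      · exact ⟨c, p', hcX, hp', h', Or.inr ⟨rfl, rfl⟩⟩
      · exact ⟨p, c, hp, hcX, h.symm, Or.inl ⟨rfl, rfl⟩⟩
    have ha'X := hred hdis a' ha'.1 haa.symm ha'b (Ne.symm hda')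
    have hb'X := hred hdis b' hb'.1 (Ne.symm hab') hbb.symm (Ne.symm hdb')
    obtain ⟨u, v, huX, hvX, huv, h⟩ := hcross ha.1 ha'.1 ha.2 ha'.2 hQ.1 ha'X
    obtain ⟨u', v', huX', hvX', huv', h'⟩ := hcross hb.1 hb'.1 hb.2 hb'.2 hQ.2.1 hb'X
    have hne : (u, v) ≠ (u', v') := by
      rintro heq
      simp only [Prod.mk.injEq] at heq
      obtain ⟨rfl, rfl⟩ := heq
      have hc2 := two_le_degree_of_adj_leaf hT hV ha.1 ha.2.symm
      rcases h with ⟨e1, e2⟩ | ⟨e1, e2⟩ <;> rcases h' with ⟨e3, e4⟩ | ⟨e3, e4⟩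
      · exact hab (e1.symm.trans e3)
      · rw [← e2, e4, hb'.1] at hc2
        omega
      · rw [← e1, e3, hb.1] at hc2
        omega
      · exact ha'b' (e2.symm.trans e4)
    rcases eq_or_eq_of_cutSize_le_two hX huX hvX huv huX' hvX' huv' hne hxX hyX hxy with e | e
    · simp only [Prod.mk.injEq] at e
      obtain ⟨rfl, rfl⟩ := e
      rcases h with ⟨rfl, -⟩ | ⟨-, rfl⟩
      exacts [hx ha.1, hy ha'.1]
    · simp only [Prod.mk.injEq] at e
      obtain ⟨rfl, rfl⟩ := e
      rcases h' with ⟨rfl, -⟩ | ⟨-, rfl⟩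
      exacts [hx hb.1, hy hb'.1]

end Triple

/-! ### The binary tree of depth two -/

section BinaryTree

instance : DecidableRel binaryTreeDepthTwo.Adj := fun a b =>
  decidable_of_iff
    (s(a, b) ∈ ({s(0, 1), s(0, 2), s(1, 3), s(1, 4), s(2, 5), s(2, 6)} : Finset (Sym2 (Fin 7))) ∧
      a ≠ b)
    (by
      unfold binaryTreeDepthTwo
      rw [fromEdgeSet_adj]
      simp only [Finset.mem_insert, Finset.mem_singleton, Set.mem_insert_iff,
        Set.mem_singleton_iff])

theorem binaryTreeDepthTwo_isTree : binaryTreeDepthTwo.IsTree := by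
  rw [isTree_iff_connected_and_card]
  constructor
  · have h : ∀ v, binaryTreeDepthTwo.Reachable 0 v := by
      have h1 : binaryTreeDepthTwo.Reachable 0 1 := Adj.reachable (by decide)
      have h2 : binaryTreeDepthTwo.Reachable 0 2 := Adj.reachable (by decide)
      intro v
      fin_cases v
      · exact Reachable.refl _
      · exact h1
      · exact h2
      · exact h1.trans (Adj.reachable (by decide))
      · exact h1.trans (Adj.reachable (by decide))
      · exact h2.trans (Adj.reachable (by decide))
      · exact h2.trans (Adj.reachable (by decide))
    exact ⟨fun a b => (h a).symm.trans (h b)⟩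
  · have h : ∑ v, binaryTreeDepthTwo.degree v = 12 := by decide
    rw [sum_degrees_eq_twice_card_edges] at h
    rw [Nat.card_eq_fintype_card, ← edgeFinset_card, Nat.card_eq_fintype_card, Fintype.card_fin]
    omega

theorem binaryTreeDepthTwo_not_adj (a b : Fin 7) (ha : binaryTreeDepthTwo.degree a = 1)
    (hb : binaryTreeDepthTwo.degree b = 2) : ¬ binaryTreeDepthTwo.Adj a b := by
  revert a b
  decide

variable {V : Type*} [Fintype V] [DecidableEq V] {T : SimpleGraph V} [DecidableRel T.Adj]

theorem numDegree_eq_of_iso (φ : T ≃g binaryTreeDepthTwo) (d : ℕ) :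
    numDegree T d = numDegree binaryTreeDepthTwo d := by
  unfold numDegree
  refine Finset.card_bij (fun v _ => φ v) ?_ (fun _ _ _ _ h => φ.injective h) fun b hb => ?_
  · intro v hv
    simpa using hv
  · refine ⟨φ.symm b, ?_, by simp⟩
    simpa using hb

/-- A vertex `w` whose two neighbours each have two further neighbours, all leaves, is the root
of a binary tree of depth `2`. -/
theorem nonempty_iso_binaryTreeDepthTwo (hT : T.IsTree) {w p q a b c d : V} (hpq : p ≠ q)
    (hw : T.neighborFinset w = {p, q}) (hp : T.neighborFinset p = {w, a, b})
    (hq : T.neighborFinset q = {w, c, d}) (hab : a ≠ b) (hcd : c ≠ d)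
    (hp3 : T.degree p = 3) (hq3 : T.degree q = 3)
    (ha : T.degree a = 1) (hb : T.degree b = 1) (hc : T.degree c = 1) (hd : T.degree d = 1) :
    Nonempty (T ≃g binaryTreeDepthTwo) := by
  have hw2 : T.degree w = 2 := by rw [← card_neighborFinset_eq_degree, hw, Finset.card_pair hpq]
  have hleaf : ∀ {x y}, T.degree x = 1 → T.Adj y x → T.neighborFinset x = {y} := by
    intro x y hx hyx
    ext z
    simp only [mem_neighborFinset, Finset.mem_singleton]
    exact ⟨fun h => eq_of_degree_eq_one hx hyx.symm h, fun h => h ▸ hyx.symm⟩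
  have hpa : T.Adj p a := by rw [← mem_neighborFinset, hp]; simp
  have hpb : T.Adj p b := by rw [← mem_neighborFinset, hp]; simp
  have hqc : T.Adj q c := by rw [← mem_neighborFinset, hq]; simp
  have hqd : T.Adj q d := by rw [← mem_neighborFinset, hq]; simp
  have hne : ∀ {x y}, T.degree x = 1 → T.Adj p x → T.Adj q y → x ≠ y := by
    rintro x y hx hpx hqx rfl
    exact hpq (eq_of_degree_eq_one hx hqx.symm hpx.symm)
  have hac := hne ha hpa hqc
  have had := hne ha hpa hqd
  have hbc := hne hb hpb hqc
  have hbd := hne hb hpb hqd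
  have hdeg : ∀ {x y}, T.degree x ≠ T.degree y → x ≠ y := by
    rintro x y h rfl
    exact h rfl
  let g : Fin 7 → V := ![w, p, q, a, b, c, d]
  have hinj : Function.Injective g := by
    have h1 : ∀ x ∈ ({p, q, a, b, c, d} : Finset V), w ≠ x := by
      intro x hx
      simp only [Finset.mem_insert, Finset.mem_singleton] at hx
      rcases hx with rfl | rfl | rfl | rfl | rfl | rfl <;> apply hdeg <;> omega
    have h2 : ∀ x ∈ ({a, b, c, d} : Finset V), p ≠ x ∧ q ≠ x := by
      intro x hx
      simp only [Finset.mem_insert, Finset.mem_singleton] at hx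
      rcases hx with rfl | rfl | rfl | rfl <;> constructor <;> apply hdeg <;> omega
    simp only [Finset.mem_insert, Finset.mem_singleton, forall_eq_or_imp, forall_eq] at h1 h2
    rw [← List.nodup_ofFn]
    simp only [g, List.ofFn_succ, List.ofFn_zero, Matrix.cons_val_zero, Matrix.cons_val_succ,
      List.nodup_cons, List.mem_cons, List.not_mem_nil, or_false, not_or]
    simp_all
  have hN : ∀ i, T.neighborFinset (g i) = (binaryTreeDepthTwo.neighborFinset i).image g := by
    have e0 : binaryTreeDepthTwo.neighborFinset 0 = {1, 2} := by decide
    have e1 : binaryTreeDepthTwo.neighborFinset 1 = {0, 3, 4} := by decide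
    have e2 : binaryTreeDepthTwo.neighborFinset 2 = {0, 5, 6} := by decide
    have e3 : binaryTreeDepthTwo.neighborFinset 3 = {1} := by decide
    have e4 : binaryTreeDepthTwo.neighborFinset 4 = {1} := by decide
    have e5 : binaryTreeDepthTwo.neighborFinset 5 = {2} := by decide
    have e6 : binaryTreeDepthTwo.neighborFinset 6 = {2} := by decide
    intro i
    fin_cases i
    · exact hw.trans (by simp only [Fin.zero_eta, e0, Finset.image_insert, Finset.image_singleton]; rfl)
    · exact hp.trans (by simp only [Fin.mk_one, e1, Finset.image_insert, Finset.image_singleton]; rfl)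
    · exact hq.trans (by simp only [Fin.reduceFinMk, e2, Finset.image_insert, Finset.image_singleton]; rfl)
    · exact (hleaf ha hpa).trans (by simp only [Fin.reduceFinMk, e3, Finset.image_singleton]; rfl)
    · exact (hleaf hb hpb).trans (by simp only [Fin.reduceFinMk, e4, Finset.image_singleton]; rfl)
    · exact (hleaf hc hqc).trans (by simp only [Fin.reduceFinMk, e5, Finset.image_singleton]; rfl)
    · exact (hleaf hd hqd).trans (by simp only [Fin.reduceFinMk, e6, Finset.image_singleton]; rfl)
  have hsurj : Function.Surjective g := by
    intro v
    have := hT.connected.preconnected.mem_of_closed (X := Finset.univ.image g) (by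
      intro x hx y hxy
      simp only [Finset.mem_image, Finset.mem_univ, true_and] at hx
      obtain ⟨i, rfl⟩ := hx
      rw [← mem_neighborFinset, hN] at hxy
      exact Finset.image_subset_image (Finset.subset_univ _) hxy)
      (Finset.mem_image_of_mem g (Finset.mem_univ 0)) v
    simpa using this
  refine ⟨(RelIso.symm ⟨Equiv.ofBijective g ⟨hinj, hsurj⟩, ?_⟩ : T ≃g binaryTreeDepthTwo)⟩
  intro i j
  change T.Adj (g i) (g j) ↔ _
  rw [← mem_neighborFinset, hN, Finset.mem_image, ← mem_neighborFinset]
  exact ⟨fun ⟨k, hk, h⟩ => hinj h ▸ hk, fun h => ⟨j, h, rfl⟩⟩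

/-- If three leaves and all others with a neighbour of degree at least `3` are at distance `2`
from `w`, through vertices of degree `3`, then no leaf is adjacent to `w`; with four such leaves
the tree is the binary tree of depth `2`. -/
theorem cherries_at_degree_two (hT : T.IsTree) {w : V} (hw : T.degree w = 2)
    (h : ∀ l, T.degree l = 1 → 3 ≤ T.degree (someNeighbor T l) →
      T.degree (someNeighbor T l) = 3 ∧ T.Adj (someNeighbor T l) w)
    (hF : 3 ≤ (Finset.univ.filter fun l =>
      T.degree l = 1 ∧ 3 ≤ T.degree (someNeighbor T l)).card) :
    (∀ l, T.degree l = 1 → ¬ T.Adj l w) ∧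
      (4 ≤ (Finset.univ.filter fun l =>
        T.degree l = 1 ∧ 3 ≤ T.degree (someNeighbor T l)).card →
        Nonempty (T ≃g binaryTreeDepthTwo)) := by
  set F := Finset.univ.filter fun l => T.degree l = 1 ∧ 3 ≤ T.degree (someNeighbor T l)
  obtain ⟨p, q, hpq, hN⟩ := Finset.card_eq_two.1 ((T.card_neighborFinset_eq_degree w).trans hw)
  have hwp : T.Adj w p := by rw [← mem_neighborFinset, hN]; simp
  have hwq : T.Adj w q := by rw [← mem_neighborFinset, hN]; simp
  have hmem : ∀ l ∈ F, (T.degree p = 3 ∧ l ∈ leavesAt T p) ∨ (T.degree q = 3 ∧ l ∈ leavesAt T q) := by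
    intro l hl
    simp only [F, Finset.mem_filter, Finset.mem_univ, true_and] at hl
    obtain ⟨h3, hadj⟩ := h l hl.1 hl.2
    have hn := (adj_someNeighbor hl.1).symm
    have := hadj.symm
    rw [← mem_neighborFinset, hN, Finset.mem_insert, Finset.mem_singleton] at this
    rcases this with e | e <;> rw [e] at h3 hn
    · exact Or.inl ⟨h3, mem_leavesAt.2 ⟨hl.1, hn⟩⟩
    · exact Or.inr ⟨h3, mem_leavesAt.2 ⟨hl.1, hn⟩⟩
  have hsub : ∀ {c}, T.Adj w c → leavesAt T c ⊆ (T.neighborFinset c).erase w := by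
    intro c hc l hl
    obtain ⟨h1, h2⟩ := mem_leavesAt.1 hl
    simp only [Finset.mem_erase, mem_neighborFinset]
    exact ⟨by rintro rfl; omega, h2⟩
  have hcard : ∀ {c}, T.Adj w c → T.degree c = 3 → ((T.neighborFinset c).erase w).card = 2 := by
    intro c hc h3
    rw [Finset.card_erase_of_mem (by simpa using hc.symm), card_neighborFinset_eq_degree, h3]
  have hle : ∀ {c}, T.Adj w c → T.degree c = 3 → (leavesAt T c).card ≤ 2 := fun hc h3 =>
    (Finset.card_le_card (hsub hc)).trans (hcard hc h3).le
  have hp3 : T.degree p = 3 := by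
    by_contra hp3
    have hFq : F ⊆ leavesAt T q := fun l hl => ((hmem l hl).resolve_left fun h => hp3 h.1).2
    obtain ⟨l, hl⟩ := Finset.card_pos.1 (show 0 < F.card by omega)
    have := hle hwq ((hmem l hl).resolve_left fun h => hp3 h.1).1
    have := Finset.card_le_card hFq
    omega
  have hq3 : T.degree q = 3 := by
    by_contra hq3
    have hFp : F ⊆ leavesAt T p := fun l hl => ((hmem l hl).resolve_right fun h => hq3 h.1).2
    have := hle hwp hp3
    have := Finset.card_le_card hFp
    omega
  refine ⟨fun l hl hlw => ?_, fun hF4 => ?_⟩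
  · have := hlw.symm
    rw [← mem_neighborFinset, hN, Finset.mem_insert, Finset.mem_singleton] at this
    rcases this with rfl | rfl <;> omega
  have hFpq : F ⊆ leavesAt T p ∪ leavesAt T q := fun l hl => Finset.mem_union.2
    ((hmem l hl).imp And.right And.right)
  have hFc := (Finset.card_le_card hFpq).trans (Finset.card_union_le _ _)
  have hcherry : ∀ {c}, T.Adj w c → T.degree c = 3 → 2 ≤ (leavesAt T c).card →
      ∃ a b, a ≠ b ∧ T.degree a = 1 ∧ T.degree b = 1 ∧ T.neighborFinset c = {w, a, b} := by
    intro c hc h3 h2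
    have he := Finset.eq_of_subset_of_card_le (hsub hc) ((hcard hc h3).le.trans h2)
    obtain ⟨a, b, hab, hl⟩ := Finset.card_eq_two.1 (le_antisymm (hle hc h3) h2)
    refine ⟨a, b, hab, (mem_leavesAt.1 (hl ▸ by simp : a ∈ leavesAt T c)).1,
      (mem_leavesAt.1 (hl ▸ by simp : b ∈ leavesAt T c)).1, ?_⟩
    rw [← Finset.insert_erase (show w ∈ T.neighborFinset c by simpa using hc.symm), ← he, hl]
  have h2p := hle hwp hp3
  have h2q := hle hwq hq3
  obtain ⟨a, b, hab, ha, hb, hp⟩ := hcherry hwp hp3 (by omega)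
  obtain ⟨c, d, hcd, hc, hd, hq⟩ := hcherry hwq hq3 (by omega)
  exact nonempty_iso_binaryTreeDepthTwo hT hpq hN hp hq hab hcd hp3 hq3 ha hb hc hd

end BinaryTree

/-! ### Good pairs -/

section GoodPair

variable {V : Type*} [Fintype V] [DecidableEq V] {T : SimpleGraph V} [DecidableRel T.Adj]

variable (T) in
/-- A leaf `l` with neighbour `v` of degree at least `3`, and a vertex `w` of degree `2`, which are
not cut off from all other vertices of degree at most `2` by at most two edges. -/
structure IsGoodPair (l v w : V) : Prop where
  leaf : T.degree l = 1
  adj : T.Adj l v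
  three_le : 3 ≤ T.degree v
  degree_eq_two : T.degree w = 2
  not_adj : T.degree v = 3 → ¬ T.Adj v w

theorem three_le_numDegree_one (hT : T.IsTree) (hV : 1 < Fintype.card V) {v : V}
    (hv : 3 ≤ T.degree v) : 3 ≤ numDegree T 1 := by
  have h : ∑ x, (2 + if x = v then 1 else 0) ≤
      ∑ x, (T.degree x + if T.degree x = 1 then 1 else 0) := by
    refine Finset.sum_le_sum fun x _ => ?_
    have := hT.degree_pos hV x
    split_ifs with h1 h2 h2
    · subst h1; omega
    · subst h1; omega
    · omega
    · omega
  have h2 := hT.sum_degree_add_two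
  rw [Finset.sum_add_distrib, Finset.sum_add_distrib, Finset.sum_const, Finset.card_univ,
    smul_eq_mul, ← Finset.card_filter, ← Finset.card_filter, Finset.filter_eq' Finset.univ v,
    if_pos (Finset.mem_univ v), Finset.card_singleton] at h
  change _ ≤ _ + numDegree T 1 at h
  omega

theorem SimpleGraph.IsTree.eq_of_common_neighbors (hT : T.IsTree) {v v' x y : V} (hxy : x ≠ y)
    (h1 : T.Adj v x) (h2 : T.Adj v y) (h3 : T.Adj v' x) (h4 : T.Adj v' y) : v = v' := by
  have := hT.isAcyclic.subsingleton_path x y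
  have h := Subsingleton.elim (α := T.Path x y)
    ⟨Walk.cons h1.symm (Walk.cons h2 Walk.nil), by simp [h1.ne', h2.ne, hxy]⟩
    ⟨Walk.cons h3.symm (Walk.cons h4 Walk.nil), by simp [h3.ne', h4.ne, hxy]⟩
  simp only [Subtype.mk.injEq, Walk.cons.injEq] at h
  exact h.1

theorem exists_isGoodPair (hT : T.IsTree) (hV : 4 ≤ Fintype.card V) (h2 : 0 < numDegree T 2)
    (h12 : numDegree T 1 = numDegree T 2 ∨ numDegree T 2 + 3 ≤ numDegree T 1)
    (hl : ∃ l, T.degree l = 1 ∧ T.degree (someNeighbor T l) ≠ 2)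
    (hiso : IsEmpty (T ≃g binaryTreeDepthTwo)) : ∃ l v w, IsGoodPair T l v w := by
  by_contra! hno
  have hbad : ∀ l w, T.degree l = 1 → 3 ≤ T.degree (someNeighbor T l) → T.degree w = 2 →
      T.degree (someNeighbor T l) = 3 ∧ T.Adj (someNeighbor T l) w := by
    intro l w hl h3 hw
    by_contra h
    exact hno l _ w ⟨hl, adj_someNeighbor hl, h3, hw, fun h3 hadj => h ⟨h3, hadj⟩⟩
  obtain ⟨l, hl, hl2⟩ := hl
  have hadj := adj_someNeighbor hl
  have hl3 : 3 ≤ T.degree (someNeighbor T l) := by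
    have := two_le_degree_of_adj_leaf hT (by omega) hl hadj
    omega
  set v := someNeighbor T l with hv
  obtain ⟨w, hw⟩ := Finset.card_pos.1 h2
  replace hw : T.degree w = 2 := (Finset.mem_filter.1 hw).2
  have hv3 : T.degree v = 3 := (hbad l w hl hl3 hw).1
  have hcardN : ((T.neighborFinset v).erase l).card = 2 := by
    rw [Finset.card_erase_of_mem (by simpa using hadj.symm), card_neighborFinset_eq_degree, hv3]
  have hsub : (Finset.univ.filter fun v => T.degree v = 2) ⊆ (T.neighborFinset v).erase l := by
    intro x hx
    have hx2 : T.degree x = 2 := (Finset.mem_filter.1 hx).2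
    simp only [Finset.mem_erase, mem_neighborFinset]
    exact ⟨by rintro rfl; omega, (hbad l x hl hl3 hx2).2⟩
  have h2le : numDegree T 2 ≤ 2 := (Finset.card_le_card hsub).trans hcardN.le
  have h13 := three_le_numDegree_one hT (by omega) hl3
  have h12' : numDegree T 2 + 3 ≤ numDegree T 1 := by omega
  have hfree := card_free_leaves_add hT (by omega)
  have hnon := card_leaves_adj_degree_two_le hT hV (Finset.univ.filter fun v => T.degree v = 2)
    (fun l w _ hw _ => by simpa using hw)
  change _ ≤ numDegree T 2 at hnon
  rcases (show numDegree T 2 = 1 ∨ numDegree T 2 = 2 by omega) with h1 | h22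
  · obtain ⟨hnw, h4⟩ := cherries_at_degree_two hT hw
      (fun l hl h3 => hbad l w hl h3 hw) (by omega)
    have hnon' := card_leaves_adj_degree_two_le hT hV ∅ (fun l x hl hx hlx => by
      obtain ⟨y, hy⟩ := Finset.card_eq_one.1 h1
      have e1 : x ∈ Finset.univ.filter fun v => T.degree v = 2 := by simpa using hx
      have e2 : w ∈ Finset.univ.filter fun v => T.degree v = 2 := by simpa using hw
      rw [hy, Finset.mem_singleton] at e1 e2
      exact (hnw l hl (e2 ▸ e1 ▸ hlx)).elim)
    rw [Finset.card_empty] at hnon'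
    exact hiso.false (h4 (by omega)).some
  · have he := Finset.eq_of_subset_of_card_le hsub (hcardN.trans h22.symm).le
    obtain ⟨x, y, hxy, hW⟩ := Finset.card_eq_two.1 h22
    have hx : T.degree x = 2 := (Finset.mem_filter.1 (hW ▸ by simp :
      x ∈ Finset.univ.filter fun v => T.degree v = 2)).2
    have hy : T.degree y = 2 := (Finset.mem_filter.1 (hW ▸ by simp :
      y ∈ Finset.univ.filter fun v => T.degree v = 2)).2
    have hone : (Finset.univ.filter fun l =>
        T.degree l = 1 ∧ 3 ≤ T.degree (someNeighbor T l)) ⊆ {l} := by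
      intro m hm
      simp only [Finset.mem_filter, Finset.mem_univ, true_and] at hm
      have hvm : v = someNeighbor T m := hT.eq_of_common_neighbors hxy
        (hbad l x hl hl3 hx).2 (hbad l y hl hl3 hy).2 (hbad m x hm.1 hm.2 hx).2
        (hbad m y hm.1 hm.2 hy).2
      rw [Finset.mem_singleton]
      by_contra hml
      have : m ∈ (T.neighborFinset v).erase l := by
        simp only [Finset.mem_erase, mem_neighborFinset]
        exact ⟨hml, hvm ▸ (adj_someNeighbor hm.1).symm⟩
      rw [← he] at this
      have := (Finset.mem_filter.1 this).2
      omega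
    have := Finset.card_le_card hone
    rw [Finset.card_singleton] at this
    omega

end GoodPair

/-! ### Sides of edges, and trees with five leaves -/

section Sides

variable {V : Type*} [Fintype V] [DecidableEq V] {T : SimpleGraph V} [DecidableRel T.Adj]

/-- Removing the edge `uv` of a tree separates the side `A` of `v` from `u`. -/
theorem SimpleGraph.IsTree.exists_side (hT : T.IsTree) {u v : V} (huv : T.Adj u v) :
    ∃ A : Finset V, v ∈ A ∧ u ∉ A ∧ ∀ x ∈ A, ∀ y ∉ A, T.Adj x y → x = v ∧ y = u := by
  classical
  have hb : T.IsBridge s(u, v) := isAcyclic_iff_forall_adj_isBridge.1 hT.isAcyclic huv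
  rw [isBridge_iff] at hb
  refine ⟨Finset.univ.filter fun x => (T.deleteEdges {s(u, v)}).Reachable v x,
    by simp, by simpa using fun h => hb h.symm, ?_⟩
  intro x hx y hy hxy
  simp only [Finset.mem_filter, Finset.mem_univ, true_and] at hx hy
  by_cases he : s(x, y) = s(u, v)
  · rw [Sym2.eq_iff] at he
    rcases he with ⟨rfl, rfl⟩ | h
    · exact (hb hx.symm).elim
    · exact h
  · refine (hy (hx.trans (Adj.reachable ?_))).elim
    rw [deleteEdges_adj]
    exact ⟨hxy, he⟩

/-- Two sides of edges, neither containing any end of the other edge outside, are disjoint. -/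
theorem disjoint_of_sides (hT : T.IsTree) {u v u' v' : V} {A B : Finset V}
    (hA : ∀ x ∈ A, ∀ y ∉ A, T.Adj x y → x = v ∧ y = u)
    (hB : ∀ x ∈ B, ∀ y ∉ B, T.Adj x y → x = v' ∧ y = u')
    (huA : u ∉ A) (hvB : v ∉ B) (hvA : v' ∉ A) : Disjoint A B := by
  rw [Finset.disjoint_left]
  intro a haA haB
  have := hT.connected.preconnected.mem_of_closed (X := A ∩ B) (by
    intro x hx y hxy
    rw [Finset.mem_inter] at hx ⊢
    by_contra h
    by_cases hyA : y ∈ A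
    · exact hvA ((hB x hx.2 y (fun hyB => h ⟨hyA, hyB⟩) hxy).1 ▸ hx.1)
    · exact hvB ((hA x hx.1 y hyA hxy).1 ▸ hx.2)) (Finset.mem_inter.2 ⟨haA, haB⟩) u
  exact huA (Finset.mem_inter.1 this).1

theorem exists_side_of_degree_eq_two (hT : T.IsTree) {w w' : V} (hw : T.degree w = 2) :
    ∃ (z : V) (A : Finset V), T.Adj w z ∧ z ∈ A ∧ w ∉ A ∧ w' ∉ A ∧
      ∀ x ∈ A, ∀ y ∉ A, T.Adj x y → x = z ∧ y = w := by
  obtain ⟨p, q, hpq, hN⟩ := Finset.card_eq_two.1 ((T.card_neighborFinset_eq_degree w).trans hw)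
  have hp : T.Adj w p := by rw [← mem_neighborFinset, hN]; simp
  have hq : T.Adj w q := by rw [← mem_neighborFinset, hN]; simp
  obtain ⟨A, hpA, hwA, hA⟩ := hT.exists_side hp
  obtain ⟨B, hqB, hwB, hB⟩ := hT.exists_side hq
  have hdisj : Disjoint A B := disjoint_of_sides hT hA hB hwA
    (fun h => hpq (hB p h w hwB hp.symm).1) (fun h => hpq (hA q h w hwA hq.symm).1.symm)
  by_cases hA' : w' ∈ A
  · exact ⟨q, B, hq, hqB, hwB, Finset.disjoint_left.1 hdisj hA', hB⟩
  · exact ⟨p, A, hp, hpA, hwA, hA', hA⟩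

/-- A side of an edge at a vertex of degree `2` that contains at most two leaves, and no vertex of
degree `2`, consists of a vertex of degree `3` and two leaves. -/
theorem cherry_of_side (hT : T.IsTree) (hV : 3 ≤ Fintype.card V) {w z : V} {A : Finset V}
    (hz : z ∈ A) (hA : ∀ x ∈ A, ∀ y ∉ A, T.Adj x y → x = z ∧ y = w) (hz1 : T.degree z ≠ 1)
    (h2 : ∀ x ∈ A, T.degree x ≠ 2) (hle : (A.filter fun x => T.degree x = 1).card ≤ 2) :
    T.degree z = 3 ∧ 2 ≤ (leavesAt T z).card := by
  set Q := A.filter fun x => T.degree x = 1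
  have hcut : T.cutSize A ≤ 1 := by
    rw [cutSize, Finset.card_le_one]
    rintro ⟨a, b⟩ h ⟨a', b'⟩ h'
    simp only [mem_interedges_iff, Finset.mem_compl] at h h'
    obtain ⟨rfl, rfl⟩ := hA a h.1 b h.2.1 h.2.2
    obtain ⟨rfl, rfl⟩ := hA a' h'.1 b' h'.2.1 h'.2.2
    rfl
  have h1 := hT.sum_degree_le ⟨z, hz⟩
  have hzQ : z ∉ Q := fun h => hz1 (Finset.mem_filter.1 h).2
  have hQA : insert z Q ⊆ A := Finset.insert_subset hz (Finset.filter_subset _ _)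
  have h3 := sum_degree_add_three_mul_le (T := T) hQA fun x hx hxQ => by
    have e1 := h2 x hx
    have e2 := hT.degree_pos (by omega) x
    have e3 : T.degree x ≠ 1 := fun h => hxQ
      (Finset.mem_insert_of_mem (Finset.mem_filter.2 ⟨hx, h⟩))
    omega
  have hz3 : 3 ≤ T.degree z := by
    have e1 := h2 z hz
    have e2 := hT.degree_pos (by omega) z
    omega
  have hQsum : ∑ x ∈ Q, T.degree x = Q.card := by
    rw [Finset.sum_congr rfl (g := fun _ => 1) (fun x hx => (Finset.mem_filter.1 hx).2)]
    simp [Q]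
  have hcardle := Finset.card_le_card hQA
  rw [Finset.sum_insert hzQ, Finset.card_insert_of_notMem hzQ, hQsum] at h3
  rw [Finset.card_insert_of_notMem hzQ] at hcardle
  have hQ2 : Q.card = 2 := by omega
  have he : insert z Q = A := Finset.eq_of_subset_of_card_le hQA
    (by rw [Finset.card_insert_of_notMem hzQ]; omega)
  refine ⟨by omega, hQ2 ▸ Finset.card_le_card fun l hl => ?_⟩
  have hl1 := (Finset.mem_filter.1 hl).2
  have hlA := (Finset.mem_filter.1 hl).1
  have hadj := adj_someNeighbor hl1
  have hnA : someNeighbor T l ∈ A := by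
    by_contra h
    exact hzQ ((hA l hlA _ h hadj).1 ▸ hl)
  rw [← he, Finset.mem_insert] at hnA
  rcases hnA with h | h
  · exact mem_leavesAt.2 ⟨hl1, h ▸ hadj.symm⟩
  · have e1 := two_le_degree_of_adj_leaf hT hV hl1 hadj
    have e2 := (Finset.mem_filter.1 h).2
    omega

/-- In a tree with five leaves and two vertices of degree `2` a good pair can be chosen such that,
once it is removed, some leaf is adjacent to a vertex of degree `2`. -/
theorem exists_isGoodPair_of_five_leaves (hT : T.IsTree) (h1 : numDegree T 1 = 5)
    (h2 : numDegree T 2 = 2) (hV : 4 ≤ Fintype.card V) :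
    ∃ l v w, IsGoodPair T l v w ∧ ∃ m u, m ≠ l ∧ u ≠ w ∧ T.degree m = 1 ∧ T.degree u = 2 ∧
      (T.Adj m u ∨ T.degree v = 3 ∧ T.Adj v m ∧ T.Adj v u) := by
  obtain ⟨x, y, hxy, hW⟩ := Finset.card_eq_two.1 h2
  have hW' : ∀ v, T.degree v = 2 ↔ v = x ∨ v = y := fun v => by
    have : v ∈ Finset.univ.filter (fun v => T.degree v = 2) ↔ v ∈ ({x, y} : Finset V) := by
      rw [hW]
    simpa using this
  have hx : T.degree x = 2 := (hW' x).2 (Or.inl rfl)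
  have hy : T.degree y = 2 := (hW' y).2 (Or.inr rfl)
  have hfree := card_free_leaves_add hT (by omega)
  by_cases hm : ∃ m u, T.degree m = 1 ∧ T.degree u = 2 ∧ T.Adj m u
  · -- The pair avoids a vertex of degree `2` that is adjacent to a leaf.
    obtain ⟨m, u, hm, hu, hmu⟩ := hm
    obtain ⟨w, hw, hwu⟩ : ∃ w, T.degree w = 2 ∧ w ≠ u := by
      rcases (hW' u).1 hu with rfl | rfl
      exacts [⟨y, hy, hxy.symm⟩, ⟨x, hx, hxy⟩]
    by_contra hno
    have hbad : ∀ l, T.degree l = 1 → 3 ≤ T.degree (someNeighbor T l) →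
        T.degree (someNeighbor T l) = 3 ∧ T.Adj (someNeighbor T l) w := by
      intro l hl h3
      by_contra h
      refine hno ⟨l, _, w, ⟨hl, adj_someNeighbor hl, h3, hw, fun h3 hadj => h ⟨h3, hadj⟩⟩,
        m, u, ?_, hwu.symm, hm, hu, Or.inl hmu⟩
      rintro rfl
      have := eq_someNeighbor hm hmu
      rw [← this] at h3
      omega
    have hnon := card_leaves_adj_degree_two_le hT hV (Finset.univ.filter fun v => T.degree v = 2)
      (fun l w _ hw _ => by simpa using hw)
    change _ ≤ numDegree T 2 at hnon
    obtain ⟨hnw, h4⟩ := cherries_at_degree_two hT hw hbad (by omega)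
    have hnon' := card_leaves_adj_degree_two_le hT hV {u} (fun l a hl ha hla => by
      rw [Finset.mem_singleton]
      by_contra hau
      have hwa : a = w := by
        rcases (hW' a).1 ha with rfl | rfl <;> rcases (hW' u).1 hu with rfl | rfl <;>
          rcases (hW' w).1 hw with rfl | rfl <;> first | rfl | contradiction
      exact hnw l hl (hwa ▸ hla))
    rw [Finset.card_singleton] at hnon'
    obtain ⟨φ⟩ := h4 (by omega)
    have := numDegree_eq_of_iso φ 2
    rw [h2] at this
    exact absurd this (by decide)
  · push Not at hm
    have key : ∀ {w w' z : V} {A : Finset V}, T.degree w = 2 → T.degree w' = 2 → w ≠ w' →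
        T.Adj w z → z ∈ A → w ∉ A → w' ∉ A →
        (∀ x ∈ A, ∀ y ∉ A, T.Adj x y → x = z ∧ y = w) →
        (A.filter fun x => T.degree x = 1).card ≤ 2 →
        ∃ l v w, IsGoodPair T l v w ∧ ∃ m u, m ≠ l ∧ u ≠ w ∧ T.degree m = 1 ∧ T.degree u = 2 ∧
          (T.Adj m u ∨ T.degree v = 3 ∧ T.Adj v m ∧ T.Adj v u) := by
      intro w w' z A hw hw' hww hwz hzA hwA hw'A hA hle
      obtain ⟨hz3, hl⟩ := cherry_of_side hT (by omega) hzA hA (fun h => hm z w h hw hwz.symm)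
        (fun v hv h => by
          have : v = w ∨ v = w' := by
            rcases (hW' v).1 h with rfl | rfl <;> rcases (hW' w).1 hw with rfl | rfl <;>
              rcases (hW' w').1 hw' with rfl | rfl <;> simp_all
          rcases this with rfl | rfl
          exacts [hwA hv, hw'A hv]) hle
      obtain ⟨l, hl, m, hm, hlm⟩ := Finset.one_lt_card.1 hl
      rw [mem_leavesAt] at hl hm
      refine ⟨l, z, w', ⟨hl.1, hl.2.symm, hz3.ge, hw', fun _ h => ?_⟩, m, w, Ne.symm hlm, hww,
        hm.1, hw, Or.inr ⟨hz3, hm.2, hwz.symm⟩⟩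
      exact hww (hA z hzA w' hw'A h).2.symm
    obtain ⟨p, A, hxp, hpA, hxA, hyA, hA⟩ := exists_side_of_degree_eq_two hT (w' := y) hx
    obtain ⟨q, B, hyq, hqB, hyB, hxB, hB⟩ := exists_side_of_degree_eq_two hT (w' := x) hy
    have hdisj : Disjoint A B := disjoint_of_sides hT hA hB hxA
      (fun h => hxy (hB p h x hxB hxp.symm).2) (fun h => hxy (hA q h y hyA hyq.symm).2.symm)
    have hle : (A.filter fun x => T.degree x = 1).card + (B.filter fun x => T.degree x = 1).card ≤
        5 := by
      rw [← h1, numDegree, ← Finset.card_union_of_disjoint (Finset.disjoint_filter_filter hdisj),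
        ← Finset.filter_union]
      exact Finset.card_le_card (Finset.filter_subset_filter _ (Finset.subset_univ _))
    rcases (show (A.filter fun x => T.degree x = 1).card ≤ 2 ∨
        (B.filter fun x => T.degree x = 1).card ≤ 2 by omega) with h | h
    · exact key hx hy hxy hxp hpA hxA hyA hA h
    · exact key hy hx hxy.symm hyq hqB hyB hxB hB h

end Sides

/-! ### The induction -/

section Induction

variable {V : Type u} [Fintype V] [DecidableEq V] {T : SimpleGraph V} [DecidableRel T.Adj]

theorem Reduction.separable_union {V' : Type*} [Fintype V'] [DecidableEq V'] {T' : SimpleGraph V'}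
    [DecidableRel T'.Adj] {f : V' ↪ V} {R : Finset V} (h : Reduction T T' f R) {k j : ℕ}
    (hs : Separable T' (lowVerts T') k) (hR : R ⊆ lowVerts T) (hne : R.Nonempty)
    (hj : R.card ≤ j + 1)
    (hcut : ∀ X : Finset V, T.cutSize X ≤ 2 → R ⊆ X → Disjoint (lowVerts T \ R) X → False) :
    Separable T (lowVerts T) (k + j) := by
  have := (h.separable hs).union (separable_of_card_le hne hj) hcut
  rwa [Finset.sdiff_union_of_subset hR] at this

theorem Reduction.separable_insert {V' : Type*} [Fintype V'] [DecidableEq V']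
    {T' : SimpleGraph V'} [DecidableRel T'.Adj] {f : V' ↪ V} {x : V} (h : Reduction T T' f {x})
    {k : ℕ} (hs : Separable T' (lowVerts T') k) (hx : x ∈ lowVerts T)
    (h2 : 2 ≤ (lowVerts T).card) : Separable T (lowVerts T) (k + 1) := by
  have h3 := Finset.card_sdiff_add_card_eq_card (Finset.singleton_subset_iff.2 hx)
  rw [Finset.card_singleton] at h3
  have := (h.separable hs).insert (Finset.card_pos.1 (by omega)) x
  rwa [Finset.insert_eq, Finset.union_comm, Finset.sdiff_union_of_subset
    (Finset.singleton_subset_iff.2 hx)] at this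

theorem IsGoodPair.exists_reduction (hT : T.IsTree) {l v w : V} (h : IsGoodPair T l v w) :
    ∃ (V' : Type u) (_ : Fintype V') (_ : DecidableEq V') (T' : SimpleGraph V')
      (_ : DecidableRel T'.Adj) (f : V' ↪ V), Reduction T T' f {l, w} ∧
      (T.degree v = 3 → ∀ a b, a ≠ b → T.Adj v (f a) → T.Adj v (f b) → T'.Adj a b) := by
  obtain ⟨V₁, _, _, T₁, _, f, hf, hadj⟩ := exists_reduction_of_leaf hT h.leaf h.adj h.three_le
  have hwl : w ≠ l := by
    rintro rfl
    have := h.leaf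
    have := h.degree_eq_two
    omega
  obtain ⟨w', rfl⟩ := hf.mem_range w (Or.inr h.degree_eq_two) (by simpa using hwl)
  obtain ⟨V₂, _, _, T₂, _, g, hg, -⟩ := exists_reduction_of_degree_eq_two hf.isTree
    ((hf.degree_eq_two w').2 h.degree_eq_two)
  refine ⟨V₂, inferInstance, inferInstance, T₂, inferInstance, g.trans f, ?_, ?_⟩
  · have := hf.trans hg
    rwa [Finset.map_singleton, ← Finset.insert_eq] at this
  · intro h3 a b hab ha hb
    exact hg.adj a b (hadj h3 _ _ (g.injective.ne hab) ha hb)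

theorem three_le_degree_of_numDegree_two_eq_zero (hT : T.IsTree) (hV : 3 ≤ Fintype.card V)
    (h2 : numDegree T 2 = 0) {l v : V} (hl : T.degree l = 1) (h : T.Adj l v) :
    3 ≤ T.degree v := by
  have h1 := two_le_degree_of_adj_leaf hT hV hl h
  have h3 : T.degree v ≠ 2 := fun hv => by
    have : v ∈ Finset.univ.filter fun v => T.degree v = 2 := by simpa using hv
    rw [Finset.card_eq_zero.1 h2] at this
    simp at this
  omega

theorem numDegree_le_card (d : ℕ) : numDegree T d ≤ Fintype.card V := Finset.card_le_univ _

theorem numDegree_of_card_eq_two (hT : T.IsTree) (hV : Fintype.card V = 2) :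
    numDegree T 1 = 2 ∧ numDegree T 2 = 0 := by
  have h : ∀ v, T.degree v = 1 := by
    intro v
    have h1 := hT.degree_pos (by omega) v
    have h2 := T.degree_lt_card_verts v
    omega
  simp [numDegree, h, hV]

theorem two_le_numDegree_one (hT : T.IsTree) (hV : 1 < Fintype.card V) : 2 ≤ numDegree T 1 := by
  have h : ∑ x : V, 2 ≤ ∑ x, (T.degree x + if T.degree x = 1 then 1 else 0) := by
    refine Finset.sum_le_sum fun x _ => ?_
    have := hT.degree_pos hV x
    split_ifs <;> omega
  have h2 := hT.sum_degree_add_two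
  rw [Finset.sum_add_distrib, Finset.sum_const, Finset.card_univ,
    smul_eq_mul, ← Finset.card_filter] at h
  change _ ≤ _ + numDegree T 1 at h
  omega

/-- Without vertices of degree `2` any leaf can be removed, and this creates no such vertex. -/
theorem exists_reduction_of_three_leaves (hT : T.IsTree) (h1 : 6 ≤ numDegree T 1)
    (h2 : numDegree T 2 = 0) {a b d : V} (hab : a ≠ b) (had : a ≠ d) (hbd : b ≠ d)
    (ha : T.degree a = 1) (hb : T.degree b = 1) (hd : T.degree d = 1) :
    ∃ (V' : Type u) (_ : Fintype V') (_ : DecidableEq V') (T' : SimpleGraph V')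
      (_ : DecidableRel T'.Adj) (f : V' ↪ V), Reduction T T' f {a, b, d} := by
  have hV := numDegree_le_card (T := T) 1
  obtain ⟨V₁, _, _, T₁, _, f, hf, -⟩ := exists_reduction_of_leaf hT ha (adj_someNeighbor ha)
    (three_le_degree_of_numDegree_two_eq_zero hT (by omega) h2 ha (adj_someNeighbor ha))
  obtain ⟨b', rfl⟩ := hf.mem_range b (Or.inl hb) (by simpa using hab.symm)
  obtain ⟨d', rfl⟩ := hf.mem_range d (Or.inl hd) (by simpa using had.symm)
  have hb' := (hf.degree_eq_one b').2 hb
  have hd' := (hf.degree_eq_one d').2 hd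
  have e1 := hf.numDegree_eq_add (Or.inl rfl)
  have e2 := hf.numDegree_eq_add (Or.inr rfl)
  rw [Finset.filter_singleton, if_pos ha, Finset.card_singleton] at e1
  have hV₁ := numDegree_le_card (T := T₁) 1
  obtain ⟨V₂, _, _, T₂, _, g, hg, -⟩ := exists_reduction_of_leaf hf.isTree hb'
    (adj_someNeighbor hb') (three_le_degree_of_numDegree_two_eq_zero hf.isTree (by omega)
      (by omega) hb' (adj_someNeighbor hb'))
  obtain ⟨d'', rfl⟩ := hg.mem_range d' (Or.inl hd')
    (by simpa using fun h => hbd (congrArg f h).symm)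
  have hd'' := (hg.degree_eq_one d'').2 hd'
  have e3 := hg.numDegree_eq_add (Or.inl rfl)
  have e4 := hg.numDegree_eq_add (Or.inr rfl)
  rw [Finset.filter_singleton, if_pos hb', Finset.card_singleton] at e3
  have hV₂ := numDegree_le_card (T := T₂) 1
  obtain ⟨V₃, _, _, T₃, _, k, hk, -⟩ := exists_reduction_of_leaf hg.isTree hd''
    (adj_someNeighbor hd'') (three_le_degree_of_numDegree_two_eq_zero hg.isTree (by omega)
      (by omega) hd'' (adj_someNeighbor hd''))
  refine ⟨V₃, inferInstance, inferInstance, T₃, inferInstance, (k.trans g).trans f, ?_⟩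
  have := hf.trans (hg.trans hk)
  rw [Finset.map_singleton, ← Finset.insert_eq, ← Finset.insert_eq, Finset.map_insert,
    Finset.map_singleton] at this
  exact this

/-- The upper bound: the vertices of degree `1` or `2` of a tree other than the edge and the
binary tree of depth `2` can be separated by the claimed number of pairs. -/
theorem separable_lowVerts (n : ℕ) : ∀ {V : Type u} [Fintype V] [DecidableEq V]
    (T : SimpleGraph V) [DecidableRel T.Adj], Fintype.card V = n → T.IsTree →
    Fintype.card V ≠ 2 → IsEmpty (T ≃g binaryTreeDepthTwo) → ∀ k,
    2 * numDegree T 1 + numDegree T 2 ≤ 3 * k → numDegree T 1 + numDegree T 2 ≤ 2 * k →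
    Separable T (lowVerts T) k := by
  induction n using Nat.strong_induction_on with
  | _ n IH =>
  intro V _ _ T _ hn hT hV2 hiso k hk1 hk2
  have hbin1 : numDegree binaryTreeDepthTwo 1 = 4 := by decide
  have hbin2 : numDegree binaryTreeDepthTwo 2 = 1 := by decide
  have hcard := card_lowVerts (T := T)
  -- The induction hypothesis for a reduction `T'` of `T`.
  have step : ∀ {V' : Type u} [Fintype V'] [DecidableEq V'] {T' : SimpleGraph V'}
      [DecidableRel T'.Adj] {f : V' ↪ V} {R : Finset V}, Reduction T T' f R → R.Nonempty →
      ¬ (numDegree T' 1 = 2 ∧ numDegree T' 2 = 0) →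
      (numDegree T' 1 = 4 → numDegree T' 2 = 1 → IsEmpty (T' ≃g binaryTreeDepthTwo)) → ∀ k',
      2 * numDegree T' 1 + numDegree T' 2 ≤ 3 * k' → numDegree T' 1 + numDegree T' 2 ≤ 2 * k' →
      Separable T' (lowVerts T') k' := by
    intro V' _ _ T' _ f R hf hR h0 hiso' k' h1 h2
    refine IH _ (hn ▸ hf.card_lt hR) T' rfl hf.isTree
      (fun h => h0 (numDegree_of_card_eq_two hf.isTree h)) ⟨fun φ => ?_⟩ k' h1 h2
    exact (hiso' ((numDegree_eq_of_iso φ 1).trans hbin1)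
      ((numDegree_eq_of_iso φ 2).trans hbin2)).false φ
  rcases (lowVerts T).eq_empty_or_nonempty with he | hne
  · exact ⟨[], by simp, fun X _ _ => Or.inl (by simp [he])⟩
  by_cases htriv : (lowVerts T).card ≤ k + 1
  · exact separable_of_card_le hne htriv
  have hV1 : Fintype.card V ≠ 1 := by
    intro h
    have h1 := (Finset.card_le_univ (lowVerts T)).trans h.le
    omega
  have hV0 : 0 < Fintype.card V := Fintype.card_pos_iff.2 hT.connected.nonempty
  have h1two := two_le_numDegree_one hT (by omega)
  have hV4 : 4 ≤ Fintype.card V := by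
    by_contra h
    have hV3 : Fintype.card V = 3 := by omega
    have := Finset.card_le_univ (lowVerts T)
    omega
  have hlow2 : 2 ≤ (lowVerts T).card := by omega
  rcases (show numDegree T 1 + 2 ≤ numDegree T 2 ∨ numDegree T 2 = numDegree T 1 + 1 ∨
      (numDegree T 1 = numDegree T 2 + 1 ∨ numDegree T 1 = numDegree T 2 + 2) ∨
      (numDegree T 1 = numDegree T 2 ∨ numDegree T 2 + 3 ≤ numDegree T 1) by omega) with
    h12 | h12 | h12 | h12
  · obtain ⟨w, w', hw, hw', hne', hadj⟩ := exists_not_adj_of_degree_eq_two hT (by omega)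
    obtain ⟨V₁, _, _, T₁, _, f, hf, -⟩ := exists_reduction_of_degree_eq_two hT hw
    obtain ⟨x, rfl⟩ := hf.mem_range w' (Or.inr hw') (by simpa using hne'.symm)
    obtain ⟨V₂, _, _, T₂, _, g, hg, -⟩ := exists_reduction_of_degree_eq_two hf.isTree
      ((hf.degree_eq_two x).2 hw')
    have h := hf.trans hg
    rw [Finset.map_singleton, ← Finset.insert_eq] at h
    have e1 := h.numDegree_eq_add (Or.inl rfl)
    have e2 := h.numDegree_eq_add (Or.inr rfl)
    rw [Finset.filter_false_of_mem (by simp [hw, hw']), Finset.card_empty] at e1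
    rw [Finset.filter_true_of_mem (by simp [hw, hw']), Finset.card_pair hne'] at e2
    have hs := step h (by simp) (by omega) (by omega) (k - 1) (by omega) (by omega)
    have := h.separable_union (j := 1) hs (by simp [Finset.insert_subset_iff, hw, hw']) (by simp)
      (by rw [Finset.card_pair hne'])
      (fun X hX hQ hdis => no_cut_of_degree_eq_two hT (by omega) hw hw' hne' hadj X hX hQ hdis)
    exact this.mono (by omega)
  · obtain ⟨w, hw⟩ := Finset.card_pos.1 (show 0 < numDegree T 2 by omega)
    replace hw : T.degree w = 2 := (Finset.mem_filter.1 hw).2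
    obtain ⟨V₁, _, _, T₁, _, f, hf, -⟩ := exists_reduction_of_degree_eq_two hT hw
    have e1 := hf.numDegree_eq_add (Or.inl rfl)
    have e2 := hf.numDegree_eq_add (Or.inr rfl)
    rw [Finset.filter_false_of_mem (by simp [hw]), Finset.card_empty] at e1
    rw [Finset.filter_true_of_mem (by simp [hw]), Finset.card_singleton] at e2
    have hs := step hf (by simp) (by omega) (by omega) (k - 1) (by omega) (by omega)
    exact (hf.separable_insert hs (by simp [hw]) hlow2).mono (by omega)
  · have hfree := card_free_leaves_add hT (by omega)
    have hnon := card_leaves_adj_degree_two_le hT hV4 (Finset.univ.filter fun v => T.degree v = 2)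
      (fun l w _ hw _ => by simpa using hw)
    change _ ≤ numDegree T 2 at hnon
    obtain ⟨l, hl⟩ := Finset.card_pos.1 (show 0 < (Finset.univ.filter fun l =>
      T.degree l = 1 ∧ 3 ≤ T.degree (someNeighbor T l)).card by omega)
    obtain ⟨hl, hl3⟩ := (Finset.mem_filter.1 hl).2
    obtain ⟨V₁, _, _, T₁, _, f, hf, -⟩ := exists_reduction_of_leaf hT hl (adj_someNeighbor hl) hl3
    have e1 := hf.numDegree_eq_add (Or.inl rfl)
    have e2 := hf.numDegree_eq_add (Or.inr rfl)
    rw [Finset.filter_true_of_mem (by simp [hl]), Finset.card_singleton] at e1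
    rw [Finset.filter_false_of_mem (by simp [hl]), Finset.card_empty] at e2
    have hs := step hf (by simp) (by omega) (by omega) (k - 1) (by omega) (by omega)
    exact (hf.separable_insert hs (by simp [hl]) hlow2).mono (by omega)
  rcases Nat.eq_zero_or_pos (numDegree T 2) with h2 | h2
  · obtain ⟨a, b, d, hab, had, hbd, ha, hb, hd, hcut⟩ :=
      exists_triple_no_cut hT (by omega) (by omega) h2
    obtain ⟨V₁, _, _, T₁, _, f, hf⟩ :=
      exists_reduction_of_three_leaves hT (by omega) h2 hab had hbd ha hb hd
    have e1 := hf.numDegree_eq_add (Or.inl rfl)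
    have e2 := hf.numDegree_eq_add (Or.inr rfl)
    have hc : ({a, b, d} : Finset V).card = 3 :=
      Finset.card_eq_three.2 ⟨a, b, d, hab, had, hbd, rfl⟩
    rw [Finset.filter_true_of_mem (by simp [ha, hb, hd]), hc] at e1
    have hs := step hf (by simp) (by omega) (by omega) (k - 2) (by omega) (by omega)
    have := hf.separable_union (j := 2) hs (by simp [Finset.insert_subset_iff, ha, hb, hd])
      (by simp) hc.le hcut
    exact this.mono (by omega)
  by_cases hsub : ∀ l, T.degree l = 1 → T.degree (someNeighbor T l) = 2
  · have hnon := card_leaves_adj_degree_two_le hT hV4 (Finset.univ.filter fun v => T.degree v = 2)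
      (fun l w _ hw _ => by simpa using hw)
    change _ ≤ numDegree T 2 at hnon
    have : (Finset.univ.filter fun l => T.degree l = 1 ∧ T.degree (someNeighbor T l) = 2).card =
        numDegree T 1 := by
      unfold numDegree
      congr 1
      ext l
      simpa using hsub l
    exact (separable_of_subdivided_leaves hT hV4 (by omega) (by omega) hsub).mono (by omega)
  have hgood : ∃ l v w, IsGoodPair T l v w ∧ (numDegree T 1 = 5 → numDegree T 2 = 2 →
      ∃ m u, m ≠ l ∧ u ≠ w ∧ T.degree m = 1 ∧ T.degree u = 2 ∧
      (T.Adj m u ∨ T.degree v = 3 ∧ T.Adj v m ∧ T.Adj v u)) := by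
    by_cases h52 : numDegree T 1 = 5 ∧ numDegree T 2 = 2
    · obtain ⟨l, v, w, h, hm⟩ := exists_isGoodPair_of_five_leaves hT h52.1 h52.2 hV4
      exact ⟨l, v, w, h, fun _ _ => hm⟩
    · push Not at hsub
      obtain ⟨l, v, w, h⟩ := exists_isGoodPair hT hV4 h2 h12 hsub hiso
      exact ⟨l, v, w, h, fun h1 h2 => (h52 ⟨h1, h2⟩).elim⟩
  obtain ⟨l, v, w, h, h52⟩ := hgood
  have hlw : l ≠ w := by
    rintro rfl
    have := h.leaf
    have := h.degree_eq_two
    omega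
  have h1three := three_le_numDegree_one hT (by omega) h.three_le
  obtain ⟨V₁, _, _, T₁, _, f, hf, hadj⟩ := h.exists_reduction hT
  have e1 := hf.numDegree_eq_add (Or.inl rfl)
  have e2 := hf.numDegree_eq_add (Or.inr rfl)
  have hc1 : (({l, w} : Finset V).filter fun x => T.degree x = 1) = {l} := by
    rw [Finset.filter_insert, if_pos h.leaf, Finset.filter_singleton, if_neg (by
      rw [h.degree_eq_two]; norm_num)]
    rfl
  have hc2 : (({l, w} : Finset V).filter fun x => T.degree x = 2) = {w} := by
    rw [Finset.filter_insert, if_neg (by rw [h.leaf]; norm_num), Finset.filter_singleton,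
      if_pos h.degree_eq_two]
  rw [hc1, Finset.card_singleton] at e1
  rw [hc2, Finset.card_singleton] at e2
  have hs := step hf (by simp) (by omega) (fun h4 h1 => ⟨fun φ => by
    obtain ⟨m, u, hml, huw, hm, hu, hmu⟩ := h52 (by omega) (by omega)
    have hmw : m ≠ w := by
      rintro rfl
      have := h.degree_eq_two
      omega
    have hul : u ≠ l := by
      rintro rfl
      have := h.leaf
      omega
    obtain ⟨m', rfl⟩ := hf.mem_range m (Or.inl hm) (by simp [hml, hmw])
    obtain ⟨u', rfl⟩ := hf.mem_range u (Or.inr hu) (by simp [huw, hul])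
    have hadj' : T₁.Adj m' u' := by
      rcases hmu with h' | ⟨h3, h', h''⟩
      · exact hf.adj _ _ h'
      · exact hadj h3 m' u' (by rintro rfl; omega) h' h''
    refine binaryTreeDepthTwo_not_adj (φ m') (φ u') ?_ ?_ (φ.map_adj_iff.2 hadj')
    · rw [φ.degree_eq]
      exact (hf.degree_eq_one m').2 hm
    · rw [φ.degree_eq]
      exact (hf.degree_eq_two u').2 hu⟩) (k - 1) (by omega) (by omega)
  have := hf.separable_union (j := 1) hs
    (by simp [Finset.insert_subset_iff, h.leaf, h.degree_eq_two]) (by simp)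
    (by rw [Finset.card_pair hlw])
    (fun X hX hQ hdis => no_cut_of_leaf_of_degree_eq_two hT (by omega) h.leaf h.adj h.three_le
      h.degree_eq_two h.not_adj X hX hQ hdis)
  exact this.mono (by omega)

end Induction

/-! ### From pairs to paths -/

section Paths

variable {V : Type*} [Fintype V] [DecidableEq V] {T : SimpleGraph V} [DecidableRel T.Adj]

theorem eq_of_adj_of_side {u v x y : V} {A : Finset V}
    (hA : ∀ x ∈ A, ∀ y ∉ A, T.Adj x y → x = v ∧ y = u) (hxy : T.Adj x y)
    (h : ¬ (x ∈ A ↔ y ∈ A)) : s(x, y) = s(u, v) := by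
  by_cases hx : x ∈ A
  · obtain ⟨rfl, rfl⟩ := hA x hx y (by tauto) hxy
    exact Sym2.eq_swap
  · obtain ⟨rfl, rfl⟩ := hA y (by tauto) x hx hxy.symm
    rfl

/-- A trail uses the only edge leaving `A` if and only if `A` separates its ends. -/
theorem mem_edges_iff_of_side {u v : V} {A : Finset V} (hv : v ∈ A) (hu : u ∉ A)
    (hA : ∀ x ∈ A, ∀ y ∉ A, T.Adj x y → x = v ∧ y = u) {a b : V} (p : T.Walk a b)
    (hp : p.IsTrail) : s(u, v) ∈ p.edges ↔ ¬ (a ∈ A ↔ b ∈ A) := by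
  induction p with
  | nil => simp
  | @cons a c b h p ih =>
    rw [Walk.isTrail_cons] at hp
    rw [Walk.edges_cons, List.mem_cons]
    by_cases he : s(u, v) = s(a, c)
    · have h1 : ¬ (a ∈ A ↔ c ∈ A) := by
        rcases Sym2.eq_iff.1 he with ⟨rfl, rfl⟩ | ⟨rfl, rfl⟩ <;> tauto
      have h2 := (ih hp.1).not.1 (he ▸ hp.2)
      tauto
    · have h1 : a ∈ A ↔ c ∈ A := by
        by_contra h1
        exact he (eq_of_adj_of_side hA h h1).symm
      have h2 := ih hp.1
      tauto

theorem GraphPath.hasEdge_iff_of_side {u v : V} {A : Finset V} (hv : v ∈ A) (hu : u ∉ A)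
    (hA : ∀ x ∈ A, ∀ y ∉ A, T.Adj x y → x = v ∧ y = u) (P : GraphPath T) :
    P.HasEdge s(u, v) ↔ ¬ (P.1 ∈ A ↔ P.2.1 ∈ A) :=
  mem_edges_iff_of_side hv hu hA _ P.2.2.2.isTrail

theorem cutSize_le_two_of_forall {X : Finset V} (e f : Sym2 V)
    (h : ∀ x ∈ X, ∀ y ∉ X, T.Adj x y → s(x, y) = e ∨ s(x, y) = f) : T.cutSize X ≤ 2 := by
  refine (Finset.card_le_card_of_injOn (t := {e, f}) (fun p : V × V => s(p.1, p.2)) ?_ ?_).trans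
    Finset.card_le_two
  · rintro ⟨x, y⟩ hp
    simp only [SetLike.mem_coe, mem_interedges_iff, Finset.mem_compl] at hp
    simpa using h x hp.1 y hp.2.1 hp.2.2
  · rintro ⟨x, y⟩ hp ⟨x', y'⟩ hp' he
    simp only [SetLike.mem_coe, mem_interedges_iff, Finset.mem_compl] at hp hp'
    rcases Sym2.eq_iff.1 he with h | ⟨rfl, rfl⟩
    · exact Prod.ext h.1 h.2
    · exact absurd hp'.1 hp.2.1

/-- Since the vertices of a tree have average degree less than `2`, every non-empty set which at
most two edges leave contains a vertex of degree at most `2`. -/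
theorem exists_mem_lowVerts (hT : T.IsTree) (hV : 1 < Fintype.card V) {X : Finset V}
    (hX : X.Nonempty) (hc : T.cutSize X ≤ 2) : ∃ v ∈ X, v ∈ lowVerts T := by
  by_contra! h
  have h1 := hT.sum_degree_le hX
  have h2 := Finset.card_nsmul_le_sum X (fun x => T.degree x) 3 (fun x hx => by
    have h3 := h x hx
    have h4 := hT.degree_pos hV x
    rw [mem_lowVerts] at h3
    omega)
  have h3 := hX.card_pos
  simp only [smul_eq_mul] at h2
  omega

theorem exists_crossing_pair (hT : T.IsTree) (hV : 1 < Fintype.card V) {D : List (V × V)}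
    (hD : ∀ X : Finset V, T.cutSize X ≤ 2 →
      (∀ p ∈ D, p.1 ∈ X ↔ p.2 ∈ X) → lowVerts T ⊆ X ∨ Disjoint (lowVerts T) X)
    {X : Finset V} (hc : T.cutSize X ≤ 2) {a b : V} (ha : a ∈ X) (hb : b ∉ X) :
    ∃ p ∈ D, ¬ (p.1 ∈ X ↔ p.2 ∈ X) := by
  by_contra! h
  obtain ⟨v, hv, hvl⟩ := exists_mem_lowVerts hT hV ⟨a, ha⟩ hc
  obtain ⟨w, hw, hwl⟩ := exists_mem_lowVerts hT hV (X := Xᶜ) ⟨b, by simpa⟩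
    (by rwa [cutSize_compl])
  rcases hD X hc (fun p hp => h p hp) with h | h
  · exact (Finset.mem_compl.1 hw) (h hwl)
  · exact Finset.disjoint_left.1 h hvl hv

/-- The paths joining the pairs of a separating list separate and cover the edges: the edges
`e` and `f` lie on the same paths if no pair crosses the symmetric difference of their sides. -/
theorem edgeSepCoverNumber_le_of_separable (hT : T.IsTree) (hV : 1 < Fintype.card V) {k : ℕ}
    (h : Separable T (lowVerts T) k) : edgeSepCoverNumber T ≤ k := by
  classical
  obtain ⟨D, hDk, hD⟩ := h
  let path : V × V → GraphPath T := fun p =>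
    ⟨p.1, p.2, (hT.connected.preconnected p.1 p.2).some.toPath⟩
  let F : Finset (GraphPath T) := (D.map path).toFinset
  have hF : F.card ≤ k := (List.toFinset_card_le _).trans (by simpa using hDk)
  have hmem : ∀ p ∈ D, path p ∈ F := fun p hp =>
    List.mem_toFinset.2 (List.mem_map_of_mem hp)
  suffices h : SeparatesEdges T F ∧ CoversEdges T F from
    (Nat.sInf_le (show F.card ∈ sepCoverSizes T from ⟨F, h.1, h.2, rfl⟩)).trans hF
  constructor
  · intro e he f hf hef
    induction e using Sym2.ind with
    | _ u v =>
    induction f using Sym2.ind with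
    | _ u' v' =>
    obtain ⟨A, hvA, huA, hA⟩ := hT.exists_side (show T.Adj u v from he)
    obtain ⟨B, hvB, huB, hB⟩ := hT.exists_side (show T.Adj u' v' from hf)
    have hA' : ∀ x y, T.Adj x y → ¬ (x ∈ A ↔ y ∈ A) → s(x, y) = s(u, v) :=
      fun x y => eq_of_adj_of_side hA
    have hB' : ∀ x y, T.Adj x y → ¬ (x ∈ B ↔ y ∈ B) → s(x, y) = s(u', v') :=
      fun x y => eq_of_adj_of_side hB
    have huv : u ∈ B ↔ v ∈ B := by
      by_contra h
      exact hef (hB' u v he h)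
    have hX : ∀ x, x ∈ symmDiff A B ↔ ¬ (x ∈ A ↔ x ∈ B) := fun x => by
      rw [Finset.mem_symmDiff]; tauto
    have hc : T.cutSize (symmDiff A B) ≤ 2 := by
      refine cutSize_le_two_of_forall s(u, v) s(u', v') fun x hx y hy hxy => ?_
      rw [hX] at hx hy
      by_cases hxA : x ∈ A ↔ y ∈ A
      · exact Or.inr (hB' x y hxy (by tauto))
      · exact Or.inl (hA' x y hxy hxA)
    obtain ⟨p, hp, hpX⟩ : ∃ p ∈ D, ¬ (p.1 ∈ symmDiff A B ↔ p.2 ∈ symmDiff A B) := by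
      by_cases hvB' : v ∈ B
      · exact exists_crossing_pair hT hV hD hc (a := u) (b := v) (by rw [hX]; tauto)
          (by rw [hX]; tauto)
      · exact exists_crossing_pair hT hV hD hc (a := v) (b := u) (by rw [hX]; tauto)
          (by rw [hX]; tauto)
    refine ⟨path p, hmem p hp, ?_⟩
    rw [GraphPath.hasEdge_iff_of_side hvA huA hA, GraphPath.hasEdge_iff_of_side hvB huB hB]
    rw [hX, hX] at hpX
    by_cases hpA : p.1 ∈ A ↔ p.2 ∈ A
    · exact Or.inr ⟨not_not.2 hpA, fun hpB => hpX (by rw [hpA, hpB])⟩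
    · refine Or.inl ⟨hpA, not_not.2 ?_⟩
      by_contra hpB
      change ¬ (p.1 ∈ B ↔ p.2 ∈ B) at hpB
      rw [not_iff] at hpA hpB
      rw [← hpA, ← hpB, not_iff_not (a := p.1 ∈ A)] at hpX
      exact hpX Iff.rfl
  · intro e he
    induction e using Sym2.ind with
    | _ u v =>
    obtain ⟨A, hvA, huA, hA⟩ := hT.exists_side (show T.Adj u v from he)
    have hc : T.cutSize A ≤ 2 := by
      refine cutSize_le_two_of_forall s(u, v) s(u, v) fun x hx y hy hxy => ?_
      obtain ⟨rfl, rfl⟩ := hA x hx y hy hxy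
      exact Or.inl Sym2.eq_swap
    obtain ⟨p, hp, hpX⟩ := exists_crossing_pair hT hV hD hc hvA huA
    exact ⟨path p, hmem p hp, (GraphPath.hasEdge_iff_of_side hvA huA hA _).2 hpX⟩

theorem GraphPath.exists_ne_hasEdge {P : GraphPath T} {w y : V} (h : P.HasEdge s(w, y))
    (h1 : w ≠ P.1) (h2 : w ≠ P.2.1) : ∃ z, z ≠ y ∧ P.HasEdge s(w, z) := by
  obtain ⟨a, b, p, hp⟩ := P
  simp only [GraphPath.HasEdge] at *
  obtain ⟨i, rfl, hi⟩ := Walk.mem_support_iff_exists_getVert.1 (p.fst_mem_support_of_mem_edges h)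
  have hi0 : i ≠ 0 := by
    rintro rfl
    exact h1 (by simp)
  have hil : i < p.length := by
    refine lt_of_le_of_ne hi ?_
    rintro rfl
    exact h2 (by simp)
  have hc := hp.ncard_neighborSet_toSubgraph_internal_eq_two hi0 hil
  have hy : y ∈ p.toSubgraph.neighborSet (p.getVert i) := by
    rw [Subgraph.mem_neighborSet, ← Subgraph.mem_edgeSet, Walk.mem_edges_toSubgraph]
    exact h
  obtain ⟨z, hz, hzy⟩ := Set.exists_ne_of_one_lt_ncard
    (s := p.toSubgraph.neighborSet (p.getVert i)) (by omega) y
  refine ⟨z, hzy, ?_⟩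
  rwa [Subgraph.mem_neighborSet, ← Subgraph.mem_edgeSet, Walk.mem_edges_toSubgraph] at hz

theorem GraphPath.ne_of_hasEdge {P : GraphPath T} {e : Sym2 V} (h : P.HasEdge e) :
    P.1 ≠ P.2.1 := by
  obtain ⟨a, b, p⟩ := P
  rintro heq
  simp only at heq
  subst heq
  rw [GraphPath.HasEdge] at h
  simp only [p.loop_eq] at h
  simp at h

end Paths

/-! ### Lower bounds -/

section LowerBound

variable {V : Type*} [Fintype V] [DecidableEq V] {T : SimpleGraph V} [DecidableRel T.Adj]

open Classical in
/-- The non-trivial paths of `F` with `v` as an end. -/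
noncomputable def pathsEndingAt (F : Finset (GraphPath T)) (v : V) : Finset (GraphPath T) :=
  F.filter fun P => P.1 ≠ P.2.1 ∧ (v = P.1 ∨ v = P.2.1)

theorem sum_card_pathsEndingAt_le (F : Finset (GraphPath T)) :
    ∑ v, (pathsEndingAt F v).card ≤ 2 * F.card := by
  classical
  simp only [pathsEndingAt, Finset.card_filter]
  rw [Finset.sum_comm, mul_comm, ← smul_eq_mul, ← Finset.sum_const]
  refine Finset.sum_le_sum fun P _ => ?_
  rw [← Finset.card_filter]
  refine (Finset.card_le_card (t := {P.1, P.2.1}) fun v hv => ?_).trans Finset.card_le_two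
  simpa using (Finset.mem_filter.1 hv).2.2

theorem mem_pathsEndingAt_of_leaf {F : Finset (GraphPath T)} {l y : V} (hl : T.degree l = 1)
    {P : GraphPath T} (hP : P ∈ F) (h : P.HasEdge s(l, y)) : P ∈ pathsEndingAt F l := by
  classical
  refine Finset.mem_filter.2 ⟨hP, P.ne_of_hasEdge h, ?_⟩
  by_contra! hno
  obtain ⟨z, hz, hz'⟩ := P.exists_ne_hasEdge h hno.1 hno.2
  exact hz (eq_of_degree_eq_one hl (Walk.adj_of_mem_edges _ h) (Walk.adj_of_mem_edges _ hz'))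

theorem pathsEndingAt_nonempty {F : Finset (GraphPath T)} (hs : SeparatesEdges T F)
    (hc : CoversEdges T F) {v : V} (hv : v ∈ lowVerts T) : (pathsEndingAt F v).Nonempty := by
  classical
  rcases mem_lowVerts.1 hv with h1 | h2
  · obtain ⟨P, hP, hPe⟩ := hc s(v, someNeighbor T v) (adj_someNeighbor h1)
    exact ⟨P, mem_pathsEndingAt_of_leaf h1 hP hPe⟩
  · obtain ⟨x, y, hxy, hN⟩ := Finset.card_eq_two.1 ((T.card_neighborFinset_eq_degree v).trans h2)
    have hN' : ∀ z, T.Adj v z ↔ z = x ∨ z = y := fun z => by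
      rw [← mem_neighborFinset, hN]; simp
    -- A path that contains only one of the edges at `v` ends there.
    have key : ∀ P ∈ F, ∀ a b, (∀ z, T.Adj v z → z = a ∨ z = b) → P.HasEdge s(v, a) →
        ¬ P.HasEdge s(v, b) → P ∈ pathsEndingAt F v := by
      intro P hP a b hab ha hb
      refine Finset.mem_filter.2 ⟨hP, P.ne_of_hasEdge ha, ?_⟩
      by_contra! hno
      obtain ⟨z, hz, hz'⟩ := P.exists_ne_hasEdge ha hno.1 hno.2
      exact hb ((hab z (Walk.adj_of_mem_edges _ hz')).resolve_left hz ▸ hz')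
    obtain ⟨P, hP, h | h⟩ := hs s(v, x) ((hN' x).2 (Or.inl rfl)) s(v, y) ((hN' y).2 (Or.inr rfl))
      (fun h => hxy (Sym2.congr_right.1 h))
    · exact ⟨P, key P hP x y (fun z hz => (hN' z).1 hz) h.1 h.2⟩
    · exact ⟨P, key P hP y x (fun z hz => ((hN' z).1 hz).symm) h.2 h.1⟩

theorem numDegree_add_le_two_mul {F : Finset (GraphPath T)} (hs : SeparatesEdges T F)
    (hc : CoversEdges T F) : numDegree T 1 + numDegree T 2 ≤ 2 * F.card := by
  rw [← card_lowVerts]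
  refine le_trans ?_ (sum_card_pathsEndingAt_le F)
  rw [Finset.card_eq_sum_ones]
  exact (Finset.sum_le_sum fun v hv => (pathsEndingAt_nonempty hs hc hv).card_pos).trans
    (Finset.sum_le_sum_of_subset (Finset.subset_univ _))

/-- Different leaves at which a single path ends belong to different paths, since their edges are
separated; hence at most `|F|` leaves are the end of only one path. -/
theorem two_mul_numDegree_add_le {F : Finset (GraphPath T)} (hT : T.IsTree)
    (hV : 3 ≤ Fintype.card V) (hs : SeparatesEdges T F) (hc : CoversEdges T F) :
    2 * numDegree T 1 + numDegree T 2 ≤ 3 * F.card := by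
  classical
  set S := Finset.univ.filter fun l => T.degree l = 1 ∧ (pathsEndingAt F l).card = 1
  have hS : S.card ≤ F.card := by
    have hex : ∀ l, ∃ P, l ∈ S → P ∈ F ∧ P.HasEdge s(l, someNeighbor T l) := by
      intro l
      by_cases hl : l ∈ S
      · obtain ⟨P, hP, h⟩ := hc s(l, someNeighbor T l) (adj_someNeighbor (Finset.mem_filter.1 hl).2.1)
        exact ⟨P, fun _ => ⟨hP, h⟩⟩
      · exact ⟨⟨l, l, Path.nil⟩, fun h => (hl h).elim⟩
    choose g hg using hex
    have huniq : ∀ l ∈ S, ∀ Q ∈ F, Q.HasEdge s(l, someNeighbor T l) → Q = g l := by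
      intro l hl Q hQ h
      have hl' := (Finset.mem_filter.1 hl).2
      exact Finset.card_le_one.1 hl'.2.le Q (mem_pathsEndingAt_of_leaf hl'.1 hQ h) (g l)
        (mem_pathsEndingAt_of_leaf hl'.1 (hg l hl).1 (hg l hl).2)
    refine Finset.card_le_card_of_injOn g (fun l hl => (hg l hl).1) ?_
    intro l hl l' hl' h
    rw [SetLike.mem_coe] at hl hl'
    by_contra hne
    have h1 := (Finset.mem_filter.1 hl).2.1
    have h1' := (Finset.mem_filter.1 hl').2.1
    by_cases he : s(l, someNeighbor T l) = s(l', someNeighbor T l')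
    · rcases Sym2.eq_iff.1 he with ⟨h, -⟩ | ⟨-, h⟩
      · exact hne h
      · have := two_le_degree_of_adj_leaf hT hV h1 (h ▸ adj_someNeighbor h1)
        omega
    · obtain ⟨Q, hQ, ⟨hQ1, hQ2⟩ | ⟨hQ1, hQ2⟩⟩ := hs _ (adj_someNeighbor h1) _ (adj_someNeighbor h1') he
      · exact hQ2 (by rw [huniq l hl Q hQ hQ1, h]; exact (hg l' hl').2)
      · exact hQ1 (by rw [huniq l' hl' Q hQ hQ2, ← h]; exact (hg l hl).2)
  have h := sum_card_pathsEndingAt_le F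
  have hle : ∑ v : V, ((if T.degree v = 1 then 2 else 0) + if T.degree v = 2 then 1 else 0) ≤
      ∑ v : V, ((pathsEndingAt F v).card +
        if T.degree v = 1 ∧ (pathsEndingAt F v).card = 1 then 1 else 0) := by
    refine Finset.sum_le_sum fun v _ => ?_
    by_cases hv : v ∈ lowVerts T
    · have hpos := (pathsEndingAt_nonempty hs hc hv).card_pos
      split_ifs <;> omega
    · rw [mem_lowVerts, not_or] at hv
      simp [hv.1, hv.2]
  rw [Finset.sum_add_distrib, Finset.sum_add_distrib, ← Finset.card_filter,
    ← Finset.card_filter, ← Finset.sum_filter, Finset.sum_const, smul_eq_mul] at hle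
  change numDegree T 1 * 2 + numDegree T 2 ≤ _ + S.card at hle
  omega

end LowerBound

/-! ### Three paths in the binary tree of depth two -/

section BinaryTreeLower

/-- The edges on the way from the root `0` of the binary tree to a vertex, as the binary digits of
a number: the digit `i` stands for the edge above the vertex `i + 1`. -/
def rootPathMask : Fin 7 → ℕ := ![0, 1, 2, 5, 9, 18, 34]

/-- The sets of edges of paths of the binary tree of depth `2`, as binary digits. -/
def pathMasks : List ℕ :=
  [0, 1, 2, 3, 4, 5, 7, 8, 9, 11, 12, 16, 18, 19, 23, 27, 32, 34, 35, 39, 43, 48]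

theorem rootPathMask_xor_mem (a b : Fin 7) :
    rootPathMask a ^^^ rootPathMask b ∈ pathMasks := by
  revert a b
  decide

/-- The parent of the vertex `i + 1` in the binary tree of depth `2`. -/
def parentVertex : Fin 6 → Fin 7 := ![0, 0, 1, 1, 2, 2]

theorem hasEdge_iff_testBit (P : GraphPath binaryTreeDepthTwo) (i : Fin 6) :
    P.HasEdge s(parentVertex i, i.succ) ↔
      (rootPathMask P.1 ^^^ rootPathMask P.2.1).testBit i = true := by
  have hside : ∀ i : Fin 6,
      i.succ ∈ Finset.univ.filter (fun v => (rootPathMask v).testBit i = true) ∧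
      parentVertex i ∉ Finset.univ.filter (fun v => (rootPathMask v).testBit i = true) ∧
      ∀ x ∈ Finset.univ.filter (fun v => (rootPathMask v).testBit i = true),
        ∀ y ∉ Finset.univ.filter (fun v => (rootPathMask v).testBit i = true),
        binaryTreeDepthTwo.Adj x y → x = i.succ ∧ y = parentVertex i := by
    decide
  obtain ⟨h1, h2, h3⟩ := hside i
  rw [GraphPath.hasEdge_iff_of_side h1 h2 h3, Nat.testBit_xor]
  simp only [Finset.mem_filter, Finset.mem_univ, true_and]
  cases (rootPathMask P.1).testBit i <;> cases (rootPathMask P.2.1).testBit i <;> simp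

/-- Whether three sets of edges fail to separate and cover the edges. -/
def failsToSeparate (x y z : ℕ) : Bool :=
  (List.finRange 6).any fun i =>
    !(x.testBit i || y.testBit i || z.testBit i) ||
    (List.finRange 6).any fun j => decide (i < j) && x.testBit i == x.testBit j &&
      y.testBit i == y.testBit j && z.testBit i == z.testBit j

theorem exists_of_failsToSeparate {x y z : ℕ} (h : failsToSeparate x y z = true) :
    (∃ i : Fin 6, x.testBit i = false ∧ y.testBit i = false ∧ z.testBit i = false) ∨
    ∃ i j : Fin 6, i < j ∧ x.testBit i = x.testBit j ∧ y.testBit i = y.testBit j ∧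
      z.testBit i = z.testBit j := by
  rw [failsToSeparate, List.any_eq_true] at h
  obtain ⟨i, -, h⟩ := h
  rw [Bool.or_eq_true, List.any_eq_true] at h
  rcases h with h | ⟨j, -, h⟩
  · left
    simp only [Bool.not_eq_true', Bool.or_eq_false_iff] at h
    exact ⟨i, h.1.1, h.1.2, h.2⟩
  · right
    simp only [Bool.and_eq_true, decide_eq_true_eq, beq_iff_eq] at h
    exact ⟨i, j, h.1.1.1, h.1.1.2, h.1.2, h.2⟩

theorem all_failsToSeparate : (pathMasks.all fun x => pathMasks.all fun y =>
    pathMasks.all fun z => failsToSeparate x y z) = true := by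
  decide +kernel

theorem exists_forall_eq_of_card_le_three {α : Type*} [Inhabited α] {s : Finset α}
    (hs : s.card ≤ 3) : ∃ a b c, ∀ x ∈ s, x = a ∨ x = b ∨ x = c := by
  classical
  obtain ⟨a, b, c, h⟩ : ∃ a b c, s.toList ⊆ [a, b, c] := by
    rw [← Finset.length_toList] at hs
    match h : s.toList, hs with
    | [], _ => exact ⟨default, default, default, by simp⟩
    | [a], _ => exact ⟨a, a, a, by simp⟩
    | [a, b], _ => exact ⟨a, b, b, by simp⟩
    | [a, b, c], _ => exact ⟨a, b, c, by simp⟩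
  exact ⟨a, b, c, fun x hx => by simpa using h (Finset.mem_toList.2 hx)⟩

/-- Three paths do not suffice for the binary tree of depth `2`, by inspection of all triples of
paths. -/
theorem four_le_card_of_separates {F : Finset (GraphPath binaryTreeDepthTwo)}
    (hs : SeparatesEdges binaryTreeDepthTwo F) (hc : CoversEdges binaryTreeDepthTwo F) :
    4 ≤ F.card := by
  by_contra! hF
  have : Inhabited (GraphPath binaryTreeDepthTwo) := ⟨⟨0, 0, Path.nil⟩⟩
  obtain ⟨P, Q, R, hPQR⟩ := exists_forall_eq_of_card_le_three (show F.card ≤ 3 by omega)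
  have hfail := List.all_eq_true.1 (List.all_eq_true.1 (List.all_eq_true.1 all_failsToSeparate _
    (rootPathMask_xor_mem P.1 P.2.1)) _ (rootPathMask_xor_mem Q.1 Q.2.1)) _
    (rootPathMask_xor_mem R.1 R.2.1)
  have hedge : ∀ i : Fin 6, s(parentVertex i, i.succ) ∈ binaryTreeDepthTwo.edgeSet := by
    have : ∀ i : Fin 6, binaryTreeDepthTwo.Adj (parentVertex i) i.succ := by decide
    exact this
  have hinj : ∀ i j : Fin 6, i < j → s(parentVertex i, i.succ) ≠ s(parentVertex j, j.succ) := by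
    decide
  rcases exists_of_failsToSeparate hfail with ⟨i, h1, h2, h3⟩ | ⟨i, j, hij, h1, h2, h3⟩
  · obtain ⟨S, hS, hSe⟩ := hc _ (hedge i)
    rw [hasEdge_iff_testBit] at hSe
    rcases hPQR S hS with rfl | rfl | rfl
    · rw [h1] at hSe; exact absurd hSe (by decide)
    · rw [h2] at hSe; exact absurd hSe (by decide)
    · rw [h3] at hSe; exact absurd hSe (by decide)
  · obtain ⟨S, hS, hSe⟩ := hs _ (hedge i) _ (hedge j) (hinj i j hij)
    rw [hasEdge_iff_testBit, hasEdge_iff_testBit] at hSe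
    rcases hPQR S hS with rfl | rfl | rfl
    · rw [h1] at hSe; tauto
    · rw [h2] at hSe; tauto
    · rw [h3] at hSe; tauto

end BinaryTreeLower

/-! ### The separation-covering number of a tree -/

theorem theorem1 :
    edgeSepCoverNumber binaryTreeDepthTwo = 4 ∧
    ∀ {V : Type*} [Fintype V] (T : SimpleGraph V) [DecidableRel T.Adj],
      T.IsTree → Fintype.card V ≠ 2 → IsEmpty (T ≃g binaryTreeDepthTwo) →
        edgeSepCoverNumber T =
          max ⌈((2 * numDegree T 1 + numDegree T 2 : ℕ) : ℚ) / 3⌉₊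
            ⌈((numDegree T 1 + numDegree T 2 : ℕ) : ℚ) / 2⌉₊ := by
  constructor
  · apply le_antisymm
    · have hlow : (lowVerts binaryTreeDepthTwo).card = 5 := by decide
      exact edgeSepCoverNumber_le_of_separable binaryTreeDepthTwo_isTree (by decide)
        (separable_of_card_le (Finset.card_pos.1 (by omega)) (by omega))
    · obtain ⟨F, hs, hc, hF⟩ := Nat.sInf_mem (sepCoverSizes_nonempty binaryTreeDepthTwo)
      exact (four_le_card_of_separates hs hc).trans hF.le
  · intro V _ T _ hT hV hiso
    classical
    have hV0 : 0 < Fintype.card V := Fintype.card_pos_iff.2 hT.connected.nonempty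
    rcases (show Fintype.card V = 1 ∨ 3 ≤ Fintype.card V by omega) with h1 | h3
    · have hsub : Subsingleton V := Fintype.card_le_one_iff_subsingleton.1 h1.le
      have he : ∀ e, e ∉ T.edgeSet := fun e => by
        induction e using Sym2.ind with
        | _ u v => exact fun h => (mem_edgeSet T).1 h |>.ne (Subsingleton.elim u v)
      have h0 : edgeSepCoverNumber T = 0 := Nat.le_zero.1 (Nat.sInf_le
        (show 0 ∈ sepCoverSizes T from
          ⟨∅, fun e h => (he e h).elim, fun e h => (he e h).elim, rfl⟩))
      simp [h0, numDegree]
    have hthird : ∀ a k : ℕ, ⌈(a : ℚ) / 3⌉₊ ≤ k ↔ a ≤ 3 * k := fun a k => by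
      rw [Nat.ceil_le, div_le_iff₀ (by norm_num), mul_comm]
      norm_cast
    have hhalf : ∀ a k : ℕ, ⌈(a : ℚ) / 2⌉₊ ≤ k ↔ a ≤ 2 * k := fun a k => by
      rw [Nat.ceil_le, div_le_iff₀ (by norm_num), mul_comm]
      norm_cast
    apply le_antisymm
    · exact edgeSepCoverNumber_le_of_separable hT (by omega)
        (separable_lowVerts _ T rfl hT hV hiso _ ((hthird _ _).1 (le_max_left _ _))
          ((hhalf _ _).1 (le_max_right _ _)))
    · obtain ⟨F, hs, hc, hF⟩ := Nat.sInf_mem (sepCoverSizes_nonempty T)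
      change F.card = edgeSepCoverNumber T at hF
      rw [← hF]
      exact max_le ((hthird _ _).2 (two_mul_numDegree_add_le hT h3 hs hc))
        ((hhalf _ _).2 (numDegree_add_le_two_mul hs hc))
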